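/- For $n\in\mathbb N$ let $A_n$ be the set of bijections $\sigma:E(K_n)\to\{1,\dots,\binom n2\}$, where $K_n$ is the complete graph on $[n]$. For $\sigma\in A_n$ and $0\le M\le\binom n2$ let $G(n,M,\sigma)$ be the graph on $[n]$ with edge set $\{e\in E(K_n):\sigma(e)\le M\}$, and let $$M_1(\sigma)=\min\Big\{0\le M\le\tbinom n2:\ G(n,M,\sigma)\text{ has minimum degree at least }1\Big\}.$$ The $k$-core of a graph is its maximal subgraph in which every vertex has degree at least $k$. A graph is $k$-connected if it has more than $k$ vertices and remains connected after the deletion of any set of fewer than $k$ vertices. **Theorem.** Fix an integer $k\ge 3$ and let $\sigma$ be chosen uniformly at random from $A_n$. Then, with probability tending to $1$ as $n\to\infty$, the following holds: for every integer $M$ with $M_1(\sigma)\le M\le\binom n2$, the $k$-core of $G(n,M,\sigma)$ is $k$-connected and has at least $5n/9$ vertices. -/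

import Mathlib

open Filter Topology MeasureTheory ProbabilityTheory

namespace RandomCore

/-- The set `A_n` of bijections `σ : E(K_n) → {1, …, C(n,2)}`, i.e. of the edge orderings of
the complete graph on `n` labelled vertices. -/
abbrev EdgeOrdering (n : ℕ) : Type :=
  (⊤ : SimpleGraph (Fin n)).edgeSet ≃ Finset.Icc 1 (n.choose 2)

/-- Every set of edge orderings is an event. -/
instance (n : ℕ) : MeasurableSpace (EdgeOrdering n) := ⊤

instance (n : ℕ) : DiscreteMeasurableSpace (EdgeOrdering n) := ⟨fun _ => trivial⟩

/-- The uniform probability measure on the set of edge orderings. -/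
noncomputable def orderingMeasure (n : ℕ) : Measure (EdgeOrdering n) :=
  uniformOn Set.univ

/-- The graph `G(n, M, σ)` whose edges are the `e ∈ E(K_n)` with `σ(e) ≤ M`. -/
def graph {n : ℕ} (M : ℕ) (σ : EdgeOrdering n) : SimpleGraph (Fin n) :=
  SimpleGraph.fromEdgeSet
    {e | ∃ he : e ∈ (⊤ : SimpleGraph (Fin n)).edgeSet, ((σ ⟨e, he⟩ : ℕ)) ≤ M}

open Classical in
/-- The hitting time `M_d(σ) = min {0 ≤ M ≤ C(n,2) : δ(G(n, M, σ)) ≥ d}`. -/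
noncomputable def minDegreeTime {n : ℕ} (d : ℕ) (σ : EdgeOrdering n) : ℕ :=
  sInf {M : ℕ | M ≤ n.choose 2 ∧ d ≤ (graph M σ).minDegree}

/-- A sequence of properties `P n` of the points of probability spaces `(S n, μ n)` holds
asymptotically almost surely. -/
def AAS {S : ℕ → Type*} [∀ n, MeasurableSpace (S n)] (μ : ∀ n, Measure (S n))
    (P : ∀ n, S n → Prop) : Prop :=
  Tendsto (fun n => μ n {x | P n x}) atTop (𝓝 1)

/-- Every vertex of the subgraph `H` has degree at least `k` in `H`. -/
def MinDegreeGE {V : Type*} {G : SimpleGraph V} (k : ℕ) (H : G.Subgraph) : Prop :=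
  ∀ v ∈ H.verts, (k : ℕ∞) ≤ (H.neighborSet v).encard

/-- The `k`-core: the maximal subgraph in which every vertex has degree at least `k`
(the subgraph with no vertices, if there is no other). -/
def kCore {V : Type*} (G : SimpleGraph V) (k : ℕ) : G.Subgraph :=
  sSup {H : G.Subgraph | MinDegreeGE k H}

/-- The `k`-core itself has all degrees at least `k`, and it contains every other such subgraph. -/
theorem isGreatest_kCore {V : Type*} (G : SimpleGraph V) (k : ℕ) :
    IsGreatest {H : G.Subgraph | MinDegreeGE k H} (kCore G k) := by
  refine ⟨?_, fun H hH => le_sSup hH⟩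
  intro v hv
  simp only [kCore, SimpleGraph.Subgraph.verts_sSup, Set.mem_iUnion] at hv
  obtain ⟨H, hH, hvH⟩ := hv
  refine (hH v hvH).trans (Set.encard_le_encard ?_)
  exact SimpleGraph.Subgraph.neighborSet_subset_of_subgraph (le_sSup hH) v

/-- A graph is `k`-connected if it has more than `k` vertices and it stays connected
whenever fewer than `k` vertices are deleted. -/
def IsKConnected {V : Type*} (k : ℕ) (G : SimpleGraph V) : Prop :=
  (k : ℕ∞) < ENat.card V ∧
    ∀ X : Set V, X.encard < (k : ℕ∞) → (G.induce Xᶜ).Connected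

end RandomCore

/-! Two properties, one increasing and one decreasing in the edge set, control the core at all
times. `Expands` says that a set `A` of at least `a₀` vertices has an edge to every large set
missing few vertices outside `A`; `LocallySparse` says that small sets span few edges.

Deterministically, expansion forces fewer than `a₀` vertices outside the core: peeled vertices have
too few neighbours. If deleting fewer than `k` vertices disconnected the core, some separated part
`A` would have at most half of all vertices. Expansion excludes this when `A` has at least `a₀`
vertices. A smaller `A` has all its core neighbours in itself and the deleted set, which makes that
union too dense (`not_locallySparse_of_neighbors`).

With `x = log n`, let `m₀ ≈ n x / 16`, let `m₁ ≈ (2k + 6) n x`, and let `a₀ ≈ n / x ^ (8k + 2)`. A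
second moment argument gives an isolated vertex at `m₀`, so the hitting time is at least `m₀`. Union
bounds give expansion from `a₀` at `m₀`, expansion from `1` at `m₁`, and sparsity at `m₁`. By
monotonicity the first expansion persists from `m₀` on and sparsity holds up to `m₁`. After `m₁`
every nonempty set expands and sparsity is not needed. Thus four events suffice for all times at
once. -/

namespace RandomCore

/-! ### Maximality of the core -/

section Core

variable {V : Type*} {G : SimpleGraph V} {k : ℕ}

theorem subset_verts_kCore {S : Set V}
    (hS : ∀ v ∈ S, (k : ℕ∞) ≤ (G.neighborSet v ∩ S).encard) :
    (⊤ : G.Subgraph).induce S ≤ kCore G k := by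
  refine (isGreatest_kCore G k).2 fun v hv => (hS v hv).trans (Set.encard_le_encard ?_)
  rintro w ⟨hw, hwS⟩
  exact ⟨hv, hwS, hw⟩

theorem le_encard_neighborSet_inter_kCore {v : V} (hv : v ∈ (kCore G k).verts) :
    (k : ℕ∞) ≤ (G.neighborSet v ∩ (kCore G k).verts).encard :=
  ((isGreatest_kCore G k).1 v hv).trans <| Set.encard_le_encard fun _ hw =>
    ⟨(kCore G k).adj_sub hw, (kCore G k).edge_vert ((kCore G k).adj_symm hw)⟩

/-- The subgraph induced on the core's own vertex set still has all degrees at least `k`, so by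
maximality the core is induced. -/
theorem kCore_adj {u v : V} (hu : u ∈ (kCore G k).verts) (hv : v ∈ (kCore G k).verts)
    (h : G.Adj u v) : (kCore G k).Adj u v :=
  (subset_verts_kCore fun _ hw => le_encard_neighborSet_inter_kCore hw).2 ⟨hu, hv, h⟩

end Core

/-! ### Expansion and local sparsity imply a large, `k`-connected core -/

section Deterministic

open Finset

variable {V : Type*} [Fintype V] {G : SimpleGraph V} {k : ℕ}

/-- Every vertex set `A` with at least `a₀` vertices sends an edge to every large set `B` that
misses at most `k * #A` of the vertices outside `A`. -/
def Expands (G : SimpleGraph V) (k a₀ : ℕ) : Prop :=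
  ∀ A B : Finset V, Disjoint A B → a₀ ≤ #A → A.Nonempty → Fintype.card V ≤ 4 * #B →
    Fintype.card V ≤ (k + 1) * #A + #B → ∃ u ∈ A, ∃ v ∈ B, G.Adj u v

/-- Sets of at most `t` vertices span fewer than `1 + 1 / (4 * k)` edges per vertex. -/
def LocallySparse (G : SimpleGraph V) (k t : ℕ) : Prop :=
  ∀ (S : Finset V) (F : Finset (Sym2 V)), F ⊆ S.sym2 → S.Nonempty → #S ≤ t →
    (F : Set (Sym2 V)) ⊆ G.edgeSet → 4 * k * #F < (4 * k + 1) * #S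

theorem Expands.mono {G' : SimpleGraph V} {a₀ : ℕ} (h : Expands G k a₀) (hG : G ≤ G') :
    Expands G' k a₀ := fun A B h1 h2 h3 h4 h5 => by
  obtain ⟨u, hu, v, hv, huv⟩ := h A B h1 h2 h3 h4 h5
  exact ⟨u, hu, v, hv, hG huv⟩

theorem LocallySparse.anti {V : Type*} {G G' : SimpleGraph V} {k t : ℕ} (h : LocallySparse G' k t) (hG : G ≤ G') :
    LocallySparse G k t := fun S F h1 h2 h3 h4 =>
  h S F h1 h2 h3 (h4.trans (SimpleGraph.edgeSet_mono hG))

open Classical in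
/-- Peeling off vertices outside the `k`-core, one at a time. -/
theorem exists_peeled_set (G : SimpleGraph V) (k j : ℕ)
    (hj : j ≤ #{v | v ∉ (kCore G k).verts}) :
    ∃ A W : Finset V, (∀ v ∈ A, v ∉ (kCore G k).verts) ∧ #A = j ∧ #W ≤ k * j ∧
      ∀ u ∈ A, ∀ v, G.Adj u v → v ∈ A ∪ W := by
  induction j with
  | zero => exact ⟨∅, ∅, by simp⟩
  | succ j ih =>
    obtain ⟨A, W, hA, hAj, hW, hN⟩ := ih (by omega)
    -- If every vertex outside `A` had `k` neighbours outside `A`, the complement of `A` would lie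
    -- in the core.
    obtain ⟨v, hvA, hv⟩ : ∃ v, v ∉ A ∧ (G.neighborSet v ∩ {w | w ∉ A}).encard < k := by
      by_contra! hcon
      have h1 := (subset_verts_kCore (G := G) (k := k) (S := {w | w ∉ A}) fun v hv => hcon v hv).1
      have h2 : ({v | v ∉ (kCore G k).verts} : Finset V) ⊆ A := by
        intro v hv
        by_contra hvA
        exact (mem_filter.1 hv).2 (h1 hvA)
      have := card_le_card h2
      omega
    have hvK : v ∉ (kCore G k).verts := fun hvK =>
      absurd (le_encard_neighborSet_inter_kCore hvK) <| not_le.2 <| lt_of_le_of_lt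
        (Set.encard_le_encard <| Set.inter_subset_inter_right _ fun w hw hwA => hA w hwA hw) hv
    have hfin : (G.neighborSet v ∩ {w | w ∉ A}).encard = #{w | G.Adj v w ∧ w ∉ A} := by
      rw [← Set.encard_coe_eq_coe_finsetCard]
      congr 1
      ext w
      simp
    rw [hfin] at hv
    have hv' : #{w | G.Adj v w ∧ w ∉ A} < k := by exact_mod_cast hv
    refine ⟨insert v A, W ∪ ({w | G.Adj v w ∧ w ∉ A} : Finset V), ?_, ?_, ?_, ?_⟩
    · simpa using ⟨hvK, hA⟩
    · rw [card_insert_of_notMem hvA, hAj]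
    · refine (card_union_le _ _).trans ?_
      rw [mul_add]
      omega
    · intro u hu w huw
      rcases mem_insert.1 hu with rfl | hu
      · by_cases hw : w ∈ A
        · simp [hw]
        · simp [hw, huw]
      · have := hN u hu w huw
        simp only [mem_union, mem_insert] at this ⊢
        tauto

-- Otherwise `a₀` vertices can be peeled off, and all their neighbours lie in a set of size at most
-- `(k + 1) * a₀`; its complement is large enough for expansion but receives no edge.
open Classical in
theorem Expands.card_notMem_kCore_lt {a₀ : ℕ} (h : Expands G k a₀) (ha₀ : 0 < a₀)
    (hcard : 4 * ((k + 1) * a₀) ≤ Fintype.card V) :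
    #{v | v ∉ (kCore G k).verts} < a₀ := by
  by_contra! hcon
  obtain ⟨A, W, -, hAj, hW, hN⟩ := exists_peeled_set G k a₀ hcon
  have h1 : #(A ∪ W)ᶜ = Fintype.card V - #(A ∪ W) := card_compl _
  have h2 : #(A ∪ W) ≤ (k + 1) * a₀ := (card_union_le _ _).trans (by rw [hAj]; linarith)
  obtain ⟨u, hu, v, hv, huv⟩ := h A (A ∪ W)ᶜ
    (disjoint_left.2 fun x hx hx' => by simp [hx] at hx') hAj.ge (card_pos.1 (by omega))
    (by omega) (by rw [hAj]; omega)
  exact (mem_compl.1 hv) (hN u hu v huv)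

/-- Here `a` counts the vertices of `A`, `x` their outside neighbours and `e` the edges. For `a ≥ k`
the bound `h1` suffices. For small `a` it does not: `k = 3`, `a = x = 2` gives only `e ≥ 4` on four
vertices. Then `h2`, which counts the edges forced to leave `A`, is needed. -/
theorem dense_of_degree_bounds {a x e k : ℕ} (hk : 3 ≤ k) (ha : 2 ≤ a) (hx : x + 1 ≤ k)
    (h1 : k * a + x ≤ 2 * e) (h2 : a ≤ k → k * a + a * (k + 1 - a) ≤ 2 * e) :
    (4 * k + 1) * (a + x) ≤ 4 * k * e := by
  rcases le_or_gt k a with hka | hka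
  · zify at *
    nlinarith [mul_le_mul_of_nonneg_left h1 (by positivity : (0:ℤ) ≤ 4 * k),
      mul_nonneg (sub_nonneg.2 hka) (by nlinarith : (0:ℤ) ≤ 4 * k ^ 2 - 8 * k - 2),
      mul_nonneg (sub_nonneg.2 hk) (sq_nonneg (k : ℤ))]
  · have h2 := h2 hka.le
    zify [show a ≤ k + 1 by omega] at *
    have h3 := mul_le_mul_of_nonneg_left h2 (by positivity : (0:ℤ) ≤ 4 * k)
    have h4 : (0:ℤ) ≤ (a - 2) * (k - 1 - a) := mul_nonneg (by linarith) (by linarith)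
    have h5 := mul_nonneg (by positivity : (0:ℤ) ≤ 4 * k) h4
    nlinarith [mul_nonneg (sub_nonneg.2 hk) (sub_nonneg.2 hk),
      mul_nonneg (sub_nonneg.2 ha) (sub_nonneg.2 hk),
      mul_nonneg (sub_nonneg.2 ha) (mul_nonneg (sub_nonneg.2 hk) (sub_nonneg.2 hk))]

open Classical in
/-- Vertices of degree at least `k` whose neighbours lie in `A ∪ X` make `A ∪ X` dense. -/
theorem not_locallySparse_of_neighbors {t : ℕ} {A X : Finset V} (hk : 3 ≤ k) (hA : A.Nonempty)
    (hAX : Disjoint A X) (hX : #X < k) (ht : #A + k ≤ t)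
    (hdeg : ∀ v ∈ A, k ≤ #{w ∈ A ∪ X | G.Adj v w}) : ¬ LocallySparse G k t := by
  intro hs
  -- Discarding the vertices of `X` without neighbours in `A` ensures that each remaining one adds
  -- at least one to the degree sum.
  set Y : Finset V := {x ∈ X | ∃ v ∈ A, G.Adj v x} with hY
  have hYX : Y ⊆ X := filter_subset _ _
  have hAY : Disjoint A Y := hAX.mono_right hYX
  have hdeg' : ∀ v ∈ A, k ≤ #{w ∈ A | G.Adj v w} + #{w ∈ Y | G.Adj v w} := by
    intro v hv
    refine (hdeg v hv).trans ((card_le_card ?_).trans (card_union_le _ _))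
    intro w hw
    simp only [mem_filter, mem_union, hY] at hw ⊢
    rcases hw with ⟨h | h, h'⟩
    · exact Or.inl ⟨h, h'⟩
    · exact Or.inr ⟨⟨h, v, hv, h'⟩, h'⟩
  have hin : ∀ v ∈ A, #{w ∈ A | G.Adj v w} + 1 ≤ #A := by
    intro v hv
    rw [← card_erase_add_one hv]
    gcongr
    intro w hw
    simp only [mem_filter, mem_erase] at hw ⊢
    exact ⟨hw.2.ne', hw.1⟩
  let H : SimpleGraph V :=
    { Adj := fun u v => G.Adj u v ∧ ((u ∈ A ∧ v ∈ A ∪ Y) ∨ (v ∈ A ∧ u ∈ A ∪ Y))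
      symm := ⟨fun u v h => ⟨h.1.symm, h.2.symm⟩⟩
      loopless := ⟨fun u h => h.1.ne rfl⟩ }
  have hHA : ∀ v ∈ A, #{w ∈ A | G.Adj v w} + #{w ∈ Y | G.Adj v w} ≤ H.degree v := by
    intro v hv
    rw [← card_union_of_disjoint (hAY.mono (filter_subset _ _) (filter_subset _ _)),
      ← SimpleGraph.card_neighborFinset_eq_degree]
    refine card_le_card fun w hw => ?_
    simp only [mem_union, mem_filter] at hw
    rw [SimpleGraph.mem_neighborFinset]
    simp only [H, mem_union]
    tauto
  have hHY : ∀ x ∈ Y, #{v ∈ A | G.Adj v x} ≤ H.degree x := by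
    intro x hx
    rw [← SimpleGraph.card_neighborFinset_eq_degree]
    refine card_le_card fun v hv => ?_
    simp only [mem_filter] at hv
    rw [SimpleGraph.mem_neighborFinset]
    exact ⟨hv.2.symm, Or.inr ⟨hv.1, mem_union_right _ hx⟩⟩
  have hsum : ∑ v ∈ A, H.degree v + ∑ x ∈ Y, H.degree x ≤ 2 * #H.edgeFinset := by
    rw [← H.sum_degrees_eq_twice_card_edges, ← sum_union hAY]
    exact sum_le_sum_of_subset (subset_univ _)
  have hka : k * #A ≤ ∑ v ∈ A, H.degree v := by
    rw [mul_comm, ← smul_eq_mul]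
    exact card_nsmul_le_sum _ _ _ fun v hv => (hdeg' v hv).trans (hHA v hv)
  have hx1 : #Y ≤ ∑ x ∈ Y, H.degree x := by
    rw [← mul_one #Y, ← smul_eq_mul]
    refine card_nsmul_le_sum _ _ _ fun x hx => le_trans ?_ (hHY x hx)
    obtain ⟨-, v, hv, hvx⟩ := mem_filter.1 hx
    exact card_pos.2 ⟨v, mem_filter.2 ⟨hv, hvx⟩⟩
  -- A vertex of `A` has at most `#A - 1` neighbours in `A`, hence at least `k + 1 - #A` in `Y`;
  -- count these edges from the side of `Y`.
  have hx2 : #A * (k + 1 - #A) ≤ ∑ x ∈ Y, H.degree x := by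
    calc #A * (k + 1 - #A) ≤ ∑ v ∈ A, #{w ∈ Y | G.Adj v w} := by
          rw [← smul_eq_mul]
          refine card_nsmul_le_sum _ _ _ fun v hv => ?_
          have := hdeg' v hv
          have := hin v hv
          omega
      _ = ∑ x ∈ Y, #{v ∈ A | G.Adj v x} :=
          sum_card_bipartiteAbove_eq_sum_card_bipartiteBelow _
      _ ≤ _ := sum_le_sum hHY
  have hYk : #Y + 1 ≤ k := (Nat.succ_le_succ (card_le_card hYX)).trans hX
  have hA2 : 2 ≤ #A := by
    obtain ⟨v, hv⟩ := hA
    have h1 := hdeg' v hv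
    have h2 := hin v hv
    have h3 : #{w ∈ Y | G.Adj v w} ≤ #Y := card_filter_le _ _
    omega
  have hcard : #(A ∪ Y) = #A + #Y := card_union_of_disjoint hAY
  have hlt := hs (A ∪ Y) H.edgeFinset ?_ (hA.mono subset_union_left) (by omega) ?_
  · rw [hcard] at hlt
    exact absurd (dense_of_degree_bounds (e := #H.edgeFinset) hk hA2 hYk (by omega)
      fun _ => by omega) (not_le.2 hlt)
  · intro e he
    induction e using Sym2.ind with
    | _ u v =>
      rw [SimpleGraph.mem_edgeFinset, SimpleGraph.mem_edgeSet] at he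
      simp only [H, mem_union] at he
      simp only [mk_mem_sym2_iff, mem_union]
      tauto
  · intro e he
    induction e using Sym2.ind with
    | _ u v =>
      rw [mem_coe, SimpleGraph.mem_edgeFinset, SimpleGraph.mem_edgeSet] at he
      exact he.1

open Classical in
theorem no_small_separated_set {a₀ : ℕ} {A X : Finset V} (hk : 3 ≤ k) (hE : Expands G k a₀)
    (hs : a₀ ≤ 1 ∨ LocallySparse G k (a₀ + k))
    (hK : #{v | v ∉ (kCore G k).verts} < a₀) (hn : 4 * (a₀ + k) ≤ Fintype.card V)
    (hA : A.Nonempty) (hAK : ∀ v ∈ A, v ∈ (kCore G k).verts) (hAX : Disjoint A X) (hX : #X < k)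
    (hA2 : 2 * #A ≤ Fintype.card V)
    (hN : ∀ u ∈ A, ∀ v ∈ (kCore G k).verts, G.Adj u v → v ∈ A ∪ X) : False := by
  have hApos := hA.card_pos
  rcases le_or_gt a₀ #A with ha | ha
  · set U : Finset V := {v | v ∉ (kCore G k).verts}
    set B : Finset V := (U ∪ (A ∪ X))ᶜ with hB
    have h1 : #B = Fintype.card V - #(U ∪ (A ∪ X)) := card_compl _
    have h2 : #(U ∪ (A ∪ X)) ≤ #U + (#A + #X) :=
      (card_union_le _ _).trans (by gcongr; exact card_union_le _ _)
    have h3 : #A + k ≤ k * #A + 1 := by nlinarith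
    obtain ⟨u, hu, v, hv, huv⟩ := hE A B
      (disjoint_left.2 fun x hx hx' => by simp [hB, hx] at hx') ha hA (by omega)
      (by rw [add_mul]; omega)
    simp only [hB, mem_compl, mem_union, not_or] at hv
    have := hN u hu v (by simpa [U] using hv.1) huv
    simp only [mem_union] at this
    tauto
  · rcases hs with hs | hs
    · omega
    · refine not_locallySparse_of_neighbors hk hA hAX hX (by omega : #A + k ≤ a₀ + k) ?_ hs
      intro v hv
      have h := le_encard_neighborSet_inter_kCore (hAK v hv)
      have h' : (G.neighborSet v ∩ (kCore G k).verts).encard ≤ #{w ∈ A ∪ X | G.Adj v w} := by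
        rw [← Set.encard_coe_eq_coe_finsetCard]
        refine Set.encard_le_encard fun w hw => ?_
        simp only [coe_filter, Set.mem_ofPred_eq]
        exact ⟨hN v hv w hw.2 hw.1, hw.1⟩
      exact_mod_cast h.trans h'

open Classical in
theorem isKConnected_kCore {a₀ : ℕ} (hk : 3 ≤ k) (hE : Expands G k a₀)
    (hs : a₀ ≤ 1 ∨ LocallySparse G k (a₀ + k))
    (hK : #{v | v ∉ (kCore G k).verts} < a₀) (hn : 4 * (a₀ + k) ≤ Fintype.card V) :
    IsKConnected k (kCore G k).coe := by
  have hcard : Fintype.card (kCore G k).verts + #{v | v ∉ (kCore G k).verts} =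
      Fintype.card V := by
    rw [Fintype.card_subtype, ← card_univ]
    exact card_filter_add_card_filter_not _
  refine ⟨?_, fun X hX => ?_⟩
  · rw [ENat.card_eq_coe_fintype_card]
    exact_mod_cast (by omega : k < Fintype.card (kCore G k).verts)
  have hXf : #X.toFinset < k := by
    rw [← Set.coe_toFinset X, Set.encard_coe_eq_coe_finsetCard] at hX
    exact_mod_cast hX
  rw [SimpleGraph.connected_iff]
  constructor
  · by_contra hcon
    simp only [SimpleGraph.Preconnected, not_forall] at hcon
    obtain ⟨u, v, huv⟩ := hcon
    set R := (kCore G k).coe.induce Xᶜ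
    have key : ∀ Q : Finset (Xᶜ : Set (kCore G k).verts), Q.Nonempty → 2 * #Q ≤ Fintype.card V →
        (∀ w ∈ Q, ∀ z, R.Adj w z → z ∈ Q) → False := by
      intro Q hQ hQ2 hQN
      let f : (Xᶜ : Set (kCore G k).verts) → V := fun w => ((w : (kCore G k).verts) : V)
      have hf : Function.Injective f := Subtype.val_injective.comp Subtype.val_injective
      refine no_small_separated_set (A := Q.image f) (X := X.toFinset.image Subtype.val)
        hk hE hs hK hn (hQ.image _) ?_ ?_ (card_image_le.trans_lt hXf) ?_ ?_
      · intro w hw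
        obtain ⟨z, -, rfl⟩ := mem_image.1 hw
        exact z.1.2
      · rw [disjoint_left]
        intro w hw hw'
        obtain ⟨z, -, rfl⟩ := mem_image.1 hw
        obtain ⟨y, hy, hyz⟩ := mem_image.1 hw'
        rw [Subtype.val_injective hyz] at hy
        exact z.2 (by simpa using hy)
      · rwa [card_image_of_injective _ hf]
      · intro w hw z hz hwz
        obtain ⟨w, hwQ, rfl⟩ := mem_image.1 hw
        by_cases hzX : (⟨z, hz⟩ : (kCore G k).verts) ∈ X
        · exact mem_union_right _ (mem_image.2 ⟨⟨z, hz⟩, by simpa using hzX, rfl⟩)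
        · refine mem_union_left _ (mem_image.2 ⟨⟨⟨z, hz⟩, hzX⟩, hQN w hwQ _ ?_, rfl⟩)
          exact kCore_adj w.1.2 hz hwz
    have hsplit := card_filter_add_card_filter_not
      (s := (univ : Finset (Xᶜ : Set (kCore G k).verts))) (fun w => R.Reachable u w)
    have hle : #(univ : Finset (Xᶜ : Set (kCore G k).verts)) ≤ Fintype.card V :=
      Fintype.card_le_of_injective (fun w => ((w : (kCore G k).verts) : V))
        (Subtype.val_injective.comp Subtype.val_injective)
    -- The component of `u` or its complement has at most half of the vertices, and no edge leaves
    -- either.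
    rcases le_total (2 * #{w | R.Reachable u w}) (Fintype.card V) with h | h
    · refine key {w | R.Reachable u w} ⟨u, by simp⟩ h fun w hw z hwz => ?_
      rw [mem_filter] at hw ⊢
      exact ⟨mem_univ _, hw.2.trans hwz.reachable⟩
    · refine key {w | ¬ R.Reachable u w} ⟨v, by simpa using huv⟩ (by omega) fun w hw z hwz => ?_
      rw [mem_filter] at hw ⊢
      exact ⟨mem_univ _, fun hz => hw.2 (hz.trans hwz.symm.reachable)⟩
  · by_contra hcon
    rw [not_nonempty_iff] at hcon
    have h1 : X.toFinset = univ := by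
      ext w
      simp only [Set.mem_toFinset, mem_univ, iff_true]
      by_contra hw
      exact hcon.false ⟨w, hw⟩
    rw [h1, card_univ] at hXf
    omega

end Deterministic

open Finset

/-! ### Random bijections mapping given points into a given set -/

section Equiv

variable {α β : Type*} [Fintype α] [Fintype β] [DecidableEq α] [DecidableEq β]

/-- Precomposing with the transposition of `e` and `e'` exchanges the two families. -/
theorem card_equiv_mapsTo_insert_eq (T : Finset β) (F : Finset α) {e e' : α} (he : e ∉ F)
    (he' : e' ∉ F) :
    #{σ : α ≃ β | ∀ x ∈ insert e F, σ x ∈ T} = #{σ : α ≃ β | ∀ x ∈ insert e' F, σ x ∈ T} := by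
  refine card_bij' (fun σ _ => (Equiv.swap e e').trans σ) (fun σ _ => (Equiv.swap e e').trans σ)
    ?_ ?_ ?_ ?_
  · intro σ hσ
    simp only [mem_filter, mem_univ, true_and, mem_insert, forall_eq_or_imp,
      Equiv.trans_apply, Equiv.swap_apply_right] at hσ ⊢
    refine ⟨hσ.1, fun x hx => ?_⟩
    rw [Equiv.swap_apply_of_ne_of_ne (ne_of_mem_of_not_mem hx he) (ne_of_mem_of_not_mem hx he')]
    exact hσ.2 x hx
  · intro σ hσ
    simp only [mem_filter, mem_univ, true_and, mem_insert, forall_eq_or_imp,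
      Equiv.trans_apply, Equiv.swap_apply_left] at hσ ⊢
    refine ⟨hσ.1, fun x hx => ?_⟩
    rw [Equiv.swap_apply_of_ne_of_ne (ne_of_mem_of_not_mem hx he) (ne_of_mem_of_not_mem hx he')]
    exact hσ.2 x hx
  · intro σ _
    ext x
    simp
  · intro σ _
    ext x
    simp

/-- Double count pairs of a new point `e'` and a bijection: by symmetry all `e'` contribute equally,
while a bijection mapping `F` into `T` sends exactly `#T - #F` further points there. -/
theorem card_equiv_mapsTo_insert (T : Finset β) (F : Finset α) {e : α} (he : e ∉ F) :
    ((Fintype.card α : ℝ) - #F) * #{σ : α ≃ β | ∀ x ∈ insert e F, σ x ∈ T} =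
      ((#T : ℝ) - #F) * #{σ : α ≃ β | ∀ x ∈ F, σ x ∈ T} := by
  have h1 : ∑ e' ∈ Fᶜ, #{σ : α ≃ β | ∀ x ∈ insert e' F, σ x ∈ T} =
      #Fᶜ * #{σ : α ≃ β | ∀ x ∈ insert e F, σ x ∈ T} := by
    rw [← smul_eq_mul, ← sum_const]
    exact sum_congr rfl fun e' he' =>
      card_equiv_mapsTo_insert_eq T F (mem_compl.1 he') he
  have h2 : ∑ e' ∈ Fᶜ, #{σ : α ≃ β | ∀ x ∈ insert e' F, σ x ∈ T} =
      ∑ σ : α ≃ β with ∀ x ∈ F, σ x ∈ T, #{e' ∈ Fᶜ | σ e' ∈ T} := by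
    refine Eq.trans ?_ (sum_card_bipartiteAbove_eq_sum_card_bipartiteBelow
      (fun (e' : α) (σ : α ≃ β) => σ e' ∈ T))
    refine sum_congr rfl fun e' _ => congrArg card ?_
    ext σ
    simp [bipartiteAbove, and_comm]
  have h3 : ∀ σ : α ≃ β, (∀ x ∈ F, σ x ∈ T) → (#{e' ∈ Fᶜ | σ e' ∈ T} : ℝ) = #T - #F := by
    intro σ hσ
    have h : #{e' ∈ Fᶜ | σ e' ∈ T} + #F = #T := by
      rw [← card_union_of_disjoint]
      · rw [← card_map σ.toEmbedding]
        congr 1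
        ext y
        simp only [mem_map_equiv, mem_union, mem_filter, mem_compl, Equiv.apply_symm_apply]
        constructor
        · rintro (h | h)
          · exact h.2
          · simpa using hσ _ h
        · tauto
      · rw [disjoint_left]
        intro x hx
        exact mem_compl.1 (mem_filter.1 hx).1
    rw [← h]
    push_cast
    ring
  have h4 : (#Fᶜ : ℝ) = Fintype.card α - #F := by
    rw [card_compl, Nat.cast_sub (card_le_univ _)]
  have h5 := h1.symm.trans h2
  rw [← h4]
  have h6 : ((#Fᶜ * #{σ : α ≃ β | ∀ x ∈ insert e F, σ x ∈ T} : ℕ) : ℝ) =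
      ((∑ σ : α ≃ β with ∀ x ∈ F, σ x ∈ T, #{e' ∈ Fᶜ | σ e' ∈ T} : ℕ) : ℝ) := by rw [h5]
  push_cast at h6
  rw [h6, sum_congr rfl fun σ hσ => h3 σ (mem_filter.1 hσ).2, sum_const, nsmul_eq_mul, mul_comm]

/-- The probability that a random bijection from an `N`-set maps `f` given points into a given
set of size `t`. -/
noncomputable def mapsToProb (N t f : ℕ) : ℝ := ∏ i ∈ range f, ((t : ℝ) - i) / (N - i)

theorem card_equiv_mapsTo (T : Finset β) (F : Finset α) :
    (#{σ : α ≃ β | ∀ x ∈ F, σ x ∈ T} : ℝ) =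
      mapsToProb (Fintype.card α) #T #F * Fintype.card (α ≃ β) := by
  induction F using Finset.induction_on with
  | empty => simp [mapsToProb]
  | insert e F he ih =>
    have hlt : (#F : ℝ) < Fintype.card α := by
      exact_mod_cast card_lt_univ_of_notMem he
    have h := card_equiv_mapsTo_insert (β := β) T F he
    have h0 : (Fintype.card α : ℝ) - #F ≠ 0 := by linarith
    rw [ih] at h
    rw [card_insert_of_notMem he, mapsToProb, prod_range_succ, ← mapsToProb]
    field_simp
    linarith

end Equiv

theorem mapsToProb_nonneg {N t : ℕ} (h : t ≤ N) (f : ℕ) : 0 ≤ mapsToProb N t f := by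
  rcases lt_or_ge t f with hf | hf
  · rw [mapsToProb, prod_eq_zero (mem_range.2 hf) (by simp)]
  · refine prod_nonneg fun i hi => ?_
    have h1 : (i : ℝ) + 1 ≤ t := by exact_mod_cast (mem_range.1 hi).trans_le hf
    have h2 : (t : ℝ) ≤ N := by exact_mod_cast h
    exact div_nonneg (by linarith) (by linarith)

theorem mapsToProb_le_pow {N t : ℕ} (h : t ≤ N) (f : ℕ) :
    mapsToProb N t f ≤ ((t : ℝ) / N) ^ f := by
  rcases lt_or_ge t f with hf | hf
  · rw [mapsToProb, prod_eq_zero (mem_range.2 hf) (by simp)]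
    positivity
  · rw [mapsToProb, ← card_range f, ← prod_const, card_range]
    have h2 : (t : ℝ) ≤ N := by exact_mod_cast h
    refine prod_le_prod (fun i hi => ?_) (fun i hi => ?_)
    · have h1 : (i : ℝ) + 1 ≤ t := by exact_mod_cast (mem_range.1 hi).trans_le hf
      exact div_nonneg (by linarith) (by linarith)
    · have h1 : (i : ℝ) + 1 ≤ t := by exact_mod_cast (mem_range.1 hi).trans_le hf
      have h3 : (0:ℝ) ≤ i := by positivity
      rw [div_le_div_iff₀ (by linarith) (by linarith)]
      nlinarith

/-- Negative correlation: having used up `f` places in the target only lowers the later factors. -/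
theorem mapsToProb_add_le {N t f g : ℕ} (h : t ≤ N) (hf : f + g ≤ t) :
    mapsToProb N t (f + g) ≤ mapsToProb N t f * mapsToProb N t g := by
  rw [mapsToProb, prod_range_add]
  refine mul_le_mul_of_nonneg_left ?_ (mapsToProb_nonneg h f)
  have h2 : (t : ℝ) ≤ N := by exact_mod_cast h
  have hf' : (f : ℝ) + g ≤ t := by exact_mod_cast hf
  refine prod_le_prod (fun i hi => ?_) (fun i hi => ?_)
  all_goals
    have h1 : (i : ℝ) + 1 ≤ g := by exact_mod_cast mem_range.1 hi
    have h3 : (0:ℝ) ≤ f := by positivity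
    push_cast
  · exact div_nonneg (by linarith) (by linarith)
  · rw [div_le_div_iff₀ (by linarith) (by linarith)]
    nlinarith

theorem pow_le_mapsToProb {N t f : ℕ} (h : t ≤ N) (hf : f < t) :
    (((t : ℝ) - f) / (N - f)) ^ f ≤ mapsToProb N t f := by
  rw [mapsToProb, ← card_range f, ← prod_const, card_range]
  have h2 : (t : ℝ) ≤ N := by exact_mod_cast h
  have hf' : (f : ℝ) < t := by exact_mod_cast hf
  refine prod_le_prod (fun i hi => ?_) (fun i hi => ?_)
  · exact div_nonneg (by linarith) (by linarith)
  · have h1 : (i : ℝ) + 1 ≤ f := by exact_mod_cast mem_range.1 hi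
    rw [div_le_div_iff₀ (by linarith) (by linarith)]
    nlinarith

/-! ### Edge probabilities under a uniform ordering -/

section Measure

theorem card_edgeSet_top (n : ℕ) :
    Fintype.card (⊤ : SimpleGraph (Fin n)).edgeSet = n.choose 2 := by
  have h := SimpleGraph.card_edgeFinset_top_eq_card_choose_two (V := Fin n)
  rw [Fintype.card_fin] at h
  rw [← h, ← Fintype.card_coe]
  exact Fintype.card_congr (Equiv.subtypeEquivRight fun _ => SimpleGraph.mem_edgeFinset.symm)

instance (n : ℕ) : Nonempty (EdgeOrdering n) := by
  refine Fintype.card_eq.1 ?_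
  rw [card_edgeSet_top]
  simp

instance (n : ℕ) : IsProbabilityMeasure (orderingMeasure n) :=
  isProbabilityMeasure_uniformOn Set.finite_univ Set.univ_nonempty

theorem orderingMeasure_real (n : ℕ) (p : EdgeOrdering n → Prop) [DecidablePred p] :
    (orderingMeasure n).real {σ | p σ} = (#{σ | p σ} : ℝ) / Fintype.card (EdgeOrdering n) := by
  have : ({σ | p σ} : Set (EdgeOrdering n)) = (({σ | p σ} : Finset (EdgeOrdering n)) : Set _) := by
    simp
  rw [measureReal_def, orderingMeasure, uniformOn_univ, this, Measure.count_apply_finset,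
    ENNReal.toReal_div]
  simp

open Classical in
theorem orderingMeasure_real_mapsTo {n : ℕ} (F : Finset (⊤ : SimpleGraph (Fin n)).edgeSet)
    (T : Finset (Finset.Icc 1 (n.choose 2))) :
    (orderingMeasure n).real {σ | ∀ e ∈ F, σ e ∈ T} = mapsToProb (n.choose 2) #T #F := by
  have h := card_equiv_mapsTo T F
  rw [card_edgeSet_top] at h
  rw [orderingMeasure_real, div_eq_iff (by exact_mod_cast Fintype.card_ne_zero)]
  convert h

theorem mem_edgeSet_graph {n m : ℕ} {σ : EdgeOrdering n} {e : Sym2 (Fin n)}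
    (he : e ∈ (⊤ : SimpleGraph (Fin n)).edgeSet) :
    e ∈ (graph m σ).edgeSet ↔ (σ ⟨e, he⟩ : ℕ) ≤ m := by
  have h : e ∉ Sym2.diagSet := by
    have := SimpleGraph.not_isDiag_of_mem_edgeSet _ he
    simpa using this
  rw [graph, SimpleGraph.edgeSet_fromEdgeSet]
  simp only [Set.mem_sdiff, Set.mem_ofPred_eq, h, not_false_eq_true, and_true]
  exact ⟨fun ⟨_, h⟩ => h, fun h => ⟨he, h⟩⟩

theorem graph_mono {n m m' : ℕ} (h : m ≤ m') (σ : EdgeOrdering n) : graph m σ ≤ graph m' σ :=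
  SimpleGraph.fromEdgeSet_mono fun _ ⟨he, hm⟩ => ⟨he, hm.trans h⟩

theorem edgeSet_subset_top {V : Type*} (G : SimpleGraph V) :
    G.edgeSet ⊆ (⊤ : SimpleGraph V).edgeSet :=
  SimpleGraph.edgeSet_mono le_top

open Classical in
/-- The edges of `K_n` in a set of pairs, as elements of the domain of an edge ordering. -/
noncomputable def toEdges {n : ℕ} (F : Finset (Sym2 (Fin n))) :
    Finset (⊤ : SimpleGraph (Fin n)).edgeSet := {e | (e : Sym2 (Fin n)) ∈ F}

theorem card_toEdges {n : ℕ} {F : Finset (Sym2 (Fin n))}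
    (hF : (F : Set (Sym2 (Fin n))) ⊆ (⊤ : SimpleGraph (Fin n)).edgeSet) : #(toEdges F) = #F := by
  classical
  rw [← card_map (Function.Embedding.subtype _)]
  congr 1
  ext e
  simp only [toEdges, Finset.mem_map, mem_filter, mem_univ, true_and, Function.Embedding.subtype_apply]
  exact ⟨by rintro ⟨a, h, rfl⟩; exact h, fun h => ⟨⟨e, hF h⟩, h, rfl⟩⟩

theorem mem_toEdges {n : ℕ} {F : Finset (Sym2 (Fin n))} {e : (⊤ : SimpleGraph (Fin n)).edgeSet} :
    e ∈ toEdges F ↔ (e : Sym2 (Fin n)) ∈ F := by simp [toEdges]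

theorem card_late (n m : ℕ) :
    #{x : Finset.Icc 1 (n.choose 2) | m < (x : ℕ)} = n.choose 2 - m := by
  rw [← card_map (Function.Embedding.subtype _)]
  trans #(Finset.Ioc m (n.choose 2))
  · congr 1
    ext x
    simp
    omega
  · simp

theorem card_early_le (n m : ℕ) :
    #{x : Finset.Icc 1 (n.choose 2) | (x : ℕ) ≤ m} ≤ m := by
  rw [← card_map (Function.Embedding.subtype _)]
  refine (card_le_card (t := Finset.Icc 1 m) ?_).trans (by simp)
  intro x
  simp
  omega

theorem measureReal_subset_edgeSet_le {n : ℕ} (m : ℕ) (F : Finset (Sym2 (Fin n))) :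
    (orderingMeasure n).real {σ | (F : Set (Sym2 (Fin n))) ⊆ (graph m σ).edgeSet} ≤
      ((m : ℝ) / n.choose 2) ^ #F := by
  by_cases hF : (F : Set (Sym2 (Fin n))) ⊆ (⊤ : SimpleGraph (Fin n)).edgeSet
  · set T : Finset (Finset.Icc 1 (n.choose 2)) := {x | (x : ℕ) ≤ m} with hT
    have h : {σ : EdgeOrdering n | (F : Set (Sym2 (Fin n))) ⊆ (graph m σ).edgeSet} =
        {σ : EdgeOrdering n | ∀ e ∈ toEdges F, σ e ∈ T} := by
      ext σ
      simp only [Set.mem_ofPred_eq, hT, mem_filter, mem_univ, true_and]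
      constructor
      · intro h e he
        exact (mem_edgeSet_graph e.2).1 (h (mem_toEdges.1 he))
      · intro h e he
        exact (mem_edgeSet_graph (hF he)).2 (h ⟨e, hF he⟩ (mem_toEdges.2 he))
    rw [h, orderingMeasure_real_mapsTo, ← card_toEdges hF]
    refine (mapsToProb_le_pow ((card_le_univ T).trans (by simp)) _).trans ?_
    gcongr
    exact card_early_le n m
  · have h : {σ : EdgeOrdering n | (F : Set (Sym2 (Fin n))) ⊆ (graph m σ).edgeSet} = ∅ := by
      ext σ
      simp only [Set.mem_ofPred_eq, Set.mem_empty_iff_false, iff_false]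
      exact fun h => hF (h.trans (edgeSet_subset_top _))
    rw [h, measureReal_empty]
    positivity

theorem measureReal_disjoint_edgeSet {n : ℕ} (m : ℕ) {F : Finset (Sym2 (Fin n))}
    (hF : (F : Set (Sym2 (Fin n))) ⊆ (⊤ : SimpleGraph (Fin n)).edgeSet) :
    (orderingMeasure n).real {σ | ∀ e ∈ F, e ∉ (graph m σ).edgeSet} =
      mapsToProb (n.choose 2) (n.choose 2 - m) #F := by
  set T : Finset (Finset.Icc 1 (n.choose 2)) := {x | m < (x : ℕ)} with hT
  have h : {σ : EdgeOrdering n | ∀ e ∈ F, e ∉ (graph m σ).edgeSet} =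
      {σ : EdgeOrdering n | ∀ e ∈ toEdges F, σ e ∈ T} := by
    ext σ
    simp only [Set.mem_ofPred_eq, hT, mem_filter, mem_univ, true_and]
    constructor
    · intro h e he
      exact not_le.1 fun h' => h e (mem_toEdges.1 he) ((mem_edgeSet_graph e.2).2 h')
    · intro h e he h'
      exact not_le.2 (h ⟨e, hF he⟩ (mem_toEdges.2 he)) ((mem_edgeSet_graph (hF he)).1 h')
  rw [h, orderingMeasure_real_mapsTo, card_toEdges hF, hT, card_late]

theorem measureReal_disjoint_edgeSet_le {n : ℕ} (m : ℕ) {F : Finset (Sym2 (Fin n))}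
    (hF : (F : Set (Sym2 (Fin n))) ⊆ (⊤ : SimpleGraph (Fin n)).edgeSet) :
    (orderingMeasure n).real {σ | ∀ e ∈ F, e ∉ (graph m σ).edgeSet} ≤
      Real.exp (-((m : ℝ) / n.choose 2 * #F)) := by
  rw [measureReal_disjoint_edgeSet m hF]
  refine (mapsToProb_le_pow (Nat.sub_le _ _) _).trans ?_
  rw [mul_comm, ← mul_neg, Real.exp_nat_mul]
  refine pow_le_pow_left₀ (by positivity) ?_ _
  rcases le_or_gt m (n.choose 2) with h | h
  · rcases Nat.eq_zero_or_pos (n.choose 2) with h0 | h0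
    · simp [h0]
    · have h0' : (0:ℝ) < n.choose 2 := by exact_mod_cast h0
      rw [Nat.cast_sub h, sub_div, div_self h0'.ne']
      exact Real.one_sub_le_exp_neg _
  · rw [Nat.sub_eq_zero_of_le h.le]
    simp only [Nat.cast_zero, zero_div]
    positivity

end Measure

/-! ### Union bounds for expansion and local sparsity -/

theorem choose_le_div_pow_mul_exp (n s : ℕ) :
    (n.choose s : ℝ) ≤ (Real.exp 1 * (n / s)) ^ s := by
  rcases s.eq_zero_or_pos with rfl | hs
  · simp
  have hs' : (0:ℝ) < s := by exact_mod_cast hs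
  calc (n.choose s : ℝ) ≤ (n : ℝ) ^ s / s.factorial := Nat.choose_le_pow_div s n
    _ = (n / s : ℝ) ^ s * ((s : ℝ) ^ s / s.factorial) := by rw [div_pow]; field_simp
    _ ≤ (n / s : ℝ) ^ s * Real.exp s := by
      gcongr
      exact Real.pow_div_factorial_le_exp _ hs'.le _
    _ = _ := by rw [mul_pow, ← Real.exp_nat_mul, mul_one, mul_comm]

theorem sum_Icc_pow_le {q : ℝ} (h0 : 0 ≤ q) (h1 : q ≤ 1 / 2) (n : ℕ) :
    ∑ s ∈ Finset.Icc 1 n, q ^ s ≤ 2 * q := by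
  have h := geom_sum_Ico_le_of_lt_one (m := 1) (n := n + 1) h0 (by linarith)
  have h2 : Finset.Icc 1 n = Finset.Ico 1 (n + 1) := by ext; simp
  rw [h2]
  refine h.trans ?_
  rw [pow_one, div_le_iff₀ (by linarith)]
  nlinarith

/-- The number of sets with at most `w` elements. -/
theorem card_filter_card_le {V : Type*} [Fintype V] (w : ℕ) {x : ℝ} (hx0 : 0 < x) (hx1 : x ≤ 1) :
    (#{W : Finset V | #W ≤ w} : ℝ) ≤ (1 / x) ^ w * Real.exp (x * Fintype.card V) := by
  have h1 : x ^ w * #{W : Finset V | #W ≤ w} ≤ Real.exp (x * Fintype.card V) := by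
    calc x ^ w * #{W : Finset V | #W ≤ w} = ∑ W : Finset V with #W ≤ w, x ^ w := by
          rw [sum_const, nsmul_eq_mul, mul_comm]
      _ ≤ ∑ W : Finset V with #W ≤ w, x ^ #W :=
          sum_le_sum fun W hW => pow_le_pow_of_le_one hx0.le hx1 (mem_filter.1 hW).2
      _ ≤ ∑ W : Finset V, x ^ #W :=
          sum_le_sum_of_subset_of_nonneg (filter_subset _ _) fun _ _ _ => by positivity
      _ = (x + 1) ^ Fintype.card V := by
          rw [Fintype.card, ← sum_pow_mul_eq_add_pow x 1 (univ : Finset V), powerset_univ]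
          simp
      _ ≤ Real.exp x ^ Fintype.card V := by
          gcongr
          exact Real.add_one_le_exp x
      _ = _ := by rw [← Real.exp_nat_mul, mul_comm]
  rw [one_div, inv_pow, ← div_eq_inv_mul, le_div_iff₀ (by positivity), mul_comm]
  exact h1

theorem measureReal_exists_le {Ω ι : Type*} [MeasurableSpace Ω] (μ : Measure Ω)
    [IsProbabilityMeasure μ] (s : Finset ι) (p : ι → Ω → Prop) {b : ℝ}
    (h : ∀ i ∈ s, μ.real {σ | p i σ} ≤ b) : μ.real {σ | ∃ i ∈ s, p i σ} ≤ #s * b := by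
  have heq : {σ | ∃ i ∈ s, p i σ} = ⋃ i ∈ s, {σ | p i σ} := by ext; simp
  rw [heq]
  refine (measureReal_biUnion_finset_le s _).trans ((sum_le_sum h).trans ?_)
  rw [sum_const, nsmul_eq_mul]

theorem measureReal_no_edge_between_le {n : ℕ} (m : ℕ) {A B : Finset (Fin n)}
    (hAB : Disjoint A B) :
    (orderingMeasure n).real {σ | ∀ u ∈ A, ∀ v ∈ B, ¬ (graph m σ).Adj u v} ≤
      Real.exp (-((m : ℝ) / n.choose 2 * (#A * #B))) := by
  classical
  set F : Finset (Sym2 (Fin n)) := (A ×ˢ B).image fun p => s(p.1, p.2) with hF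
  have hcard : #F = #A * #B := by
    rw [hF, card_image_of_injOn, card_product]
    rintro ⟨u, v⟩ huv ⟨u', v'⟩ huv' h
    simp only [coe_product, Set.mem_prod, mem_coe] at huv huv'
    rcases Sym2.eq_iff.1 h with h | h
    · exact Prod.ext h.1 h.2
    · have hu : u = v' := h.1
      exact absurd (hu ▸ huv.1) (disjoint_right.1 hAB huv'.2)
  have hsub : (F : Set (Sym2 (Fin n))) ⊆ (⊤ : SimpleGraph (Fin n)).edgeSet := by
    intro e he
    obtain ⟨⟨u, v⟩, huv, rfl⟩ := mem_image.1 (mem_coe.1 he)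
    rw [mem_product] at huv
    simp only [SimpleGraph.mem_edgeSet, SimpleGraph.top_adj]
    exact fun h => disjoint_left.1 hAB huv.1 (h ▸ huv.2)
  have h := measureReal_disjoint_edgeSet_le m hsub
  rw [hcard] at h
  push_cast at h
  refine le_trans (measureReal_mono ?_) h
  intro σ hσ e he
  obtain ⟨⟨u, v⟩, huv, rfl⟩ := mem_image.1 he
  rw [mem_product] at huv
  exact hσ u huv.1 v huv.2

/-- For `#A = a` there are at most `(e D) ^ a` choices of `A` and `(D ^ (k + 1) * e) ^ a` of `B`,
the latter counted by complements. Each pair spans no edge with probability at most `exp (-r) ^ a`,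
since `#B ≥ n / 4`. The sum is geometric. -/
theorem measureReal_not_expands_le {n k a₀ m : ℕ} {D r : ℝ} (hn : 0 < n)
    (hD : ∀ a : ℕ, a₀ ≤ a → 0 < a → (n : ℝ) / a ≤ D) (hr : r ≤ (m : ℝ) / n.choose 2 * (n / 4))
    (hq : Real.exp 2 * D ^ (k + 2) * Real.exp (-r) ≤ 1 / 2) :
    (orderingMeasure n).real {σ | ¬ Expands (graph m σ) k a₀} ≤
      2 * (Real.exp 2 * D ^ (k + 2) * Real.exp (-r)) := by
  classical
  have hn' : (0:ℝ) < n := by exact_mod_cast hn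
  have hD0 : 0 ≤ D := le_trans (by positivity) (hD (a₀ + 1) (by omega) (by omega))
  set q := Real.exp 2 * D ^ (k + 2) * Real.exp (-r) with hq_def
  have hq0 : 0 ≤ q := by positivity
  let Bs (a : ℕ) : Finset (Finset (Fin n)) := {B | n ≤ (k + 1) * a + #B ∧ n ≤ 4 * #B}
  let bad (a : ℕ) (A B : Finset (Fin n)) (σ : EdgeOrdering n) : Prop :=
    Disjoint A B ∧ ∀ u ∈ A, ∀ v ∈ B, ¬ (graph m σ).Adj u v
  have hbad : {σ : EdgeOrdering n | ¬ Expands (graph m σ) k a₀} ⊆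
      ⋃ a ∈ {a ∈ Finset.Icc 1 n | a₀ ≤ a}, {σ | ∃ A ∈ powersetCard a (univ : Finset (Fin n)),
        ∃ B ∈ Bs a, bad a A B σ} := by
    intro σ hσ
    simp only [Set.mem_ofPred_eq, Expands, not_forall, not_exists, not_and] at hσ
    obtain ⟨A, B, hAB, hA0, hA, hB1, hB2, h⟩ := hσ
    have := card_le_univ A
    rw [Fintype.card_fin] at *
    simp only [Set.mem_iUnion]
    refine ⟨#A, ?_, A, ?_, B, ?_, hAB, h⟩
    · simp only [mem_filter, Finset.mem_Icc]
      exact ⟨⟨hA.card_pos, this⟩, hA0⟩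
    · simp
    · simp only [Bs, mem_filter, mem_univ, true_and]
      exact ⟨hB2, hB1⟩
  refine (measureReal_mono hbad (measure_ne_top _ _)).trans ((measureReal_biUnion_finset_le _ _).trans ?_)
  refine le_trans ?_ (sum_Icc_pow_le hq0 hq n)
  refine le_trans (sum_le_sum (g := fun a => q ^ a) fun a ha => ?_)
    (sum_le_sum_of_subset_of_nonneg (filter_subset _ _) fun _ _ _ => by positivity)
  simp only [mem_filter, Finset.mem_Icc] at ha
  obtain ⟨⟨ha1, han⟩, ha0⟩ := ha
  have ha1' : (0:ℝ) < a := by exact_mod_cast ha1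
  have han' : (a:ℝ) ≤ n := by exact_mod_cast han
  have hcardB : (#(Bs a) : ℝ) ≤ D ^ ((k + 1) * a) * Real.exp a := by
    have h1 : #(Bs a) ≤ #{W : Finset (Fin n) | #W ≤ (k + 1) * a} := by
      refine card_le_card_of_injOn (fun B => Bᶜ) ?_ (compl_injective.injOn)
      intro B hB
      simp only [Bs, coe_filter, mem_univ, true_and, Set.mem_ofPred_eq] at hB ⊢
      rw [card_compl, Fintype.card_fin]
      omega
    -- The weight `x = a / n` turns the exponential factor into `exp a`.
    have h2 := card_filter_card_le (V := Fin n) ((k + 1) * a) (x := a / n) (by positivity)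
      ((div_le_one hn').2 han')
    rw [Fintype.card_fin, div_mul_cancel₀ _ hn'.ne', one_div_div] at h2
    refine (Nat.cast_le.2 h1).trans (h2.trans ?_)
    gcongr
    exact hD a ha0 ha1
  have hpair : ∀ A ∈ powersetCard a (univ : Finset (Fin n)), ∀ B ∈ Bs a,
      (orderingMeasure n).real {σ | bad a A B σ} ≤ Real.exp (-r) ^ a := by
    intro A hA B hB
    by_cases hAB : Disjoint A B
    · refine (measureReal_mono fun σ hσ => hσ.2).trans
        ((measureReal_no_edge_between_le m hAB).trans ?_)
      rw [← Real.exp_nat_mul, mul_neg, (mem_powersetCard.1 hA).2]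
      refine Real.exp_le_exp.2 (neg_le_neg ?_)
      have h4 : (n : ℝ) / 4 ≤ #B := by
        have : (n : ℝ) ≤ 4 * #B := by exact_mod_cast (mem_filter.1 hB).2.2
        linarith
      calc (a : ℝ) * r ≤ a * ((m : ℝ) / n.choose 2 * (n / 4)) := by gcongr
        _ ≤ a * ((m : ℝ) / n.choose 2 * #B) := by gcongr
        _ = _ := by ring
    · have : {σ | bad a A B σ} = ∅ := by
        ext σ
        simp [bad, hAB]
      rw [this, measureReal_empty]
      positivity
  have h := measureReal_exists_le (orderingMeasure n) (powersetCard a (univ : Finset (Fin n)))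
    (fun A σ => ∃ B ∈ Bs a, bad a A B σ) fun A hA =>
      measureReal_exists_le (orderingMeasure n) (Bs a) (fun B σ => bad a A B σ) (hpair A hA)
  refine h.trans ?_
  rw [card_powersetCard, card_univ, Fintype.card_fin]
  calc (n.choose a : ℝ) * (#(Bs a) * Real.exp (-r) ^ a)
      ≤ (Real.exp 1 * D) ^ a * ((D ^ ((k + 1) * a) * Real.exp a) * Real.exp (-r) ^ a) := by
        gcongr
        refine (choose_le_div_pow_mul_exp n a).trans ?_
        gcongr
        exact hD a ha0 ha1
    _ = q ^ a := by
        have h1 : Real.exp a = Real.exp 1 ^ a := by rw [← Real.exp_nat_mul, mul_one]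
        have h2 : Real.exp 2 = Real.exp 1 * Real.exp 1 := by rw [← Real.exp_add]; norm_num
        rw [hq_def, h1, h2, pow_mul]
        simp only [← mul_pow]
        congr 1
        ring

/-- A violating set of size `s` spans `s` edges plus at least `s / (4k)` more. The first `s` edges
pay for the choice of the set up to a factor of order `n p` per vertex, with `p` the edge density;
the surplus edges supply a further factor `y` per vertex. -/
theorem measureReal_not_locallySparse_le {n k t m : ℕ} {y : ℝ} (hk : 0 < k) (hy0 : 0 ≤ y)
    (hy1 : y ≤ 1) (hp : Real.exp 1 * t * ((m : ℝ) / n.choose 2) ≤ y ^ (4 * k))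
    (hq : Real.exp 2 * n * ((m : ℝ) / n.choose 2) * y ≤ 1 / 2) :
    (orderingMeasure n).real {σ | ¬ LocallySparse (graph m σ) k t} ≤
      2 * (Real.exp 2 * n * ((m : ℝ) / n.choose 2) * y) := by
  classical
  set p : ℝ := (m : ℝ) / n.choose 2 with hp_def
  have hp0 : 0 ≤ p := by positivity
  set q := Real.exp 2 * n * p * y with hq_def
  have hq0 : 0 ≤ q := by positivity
  -- This is `s / (4 * k)` rounded up, the least possible surplus of edges.
  let c (s : ℕ) : ℕ := (s + 4 * k - 1) / (4 * k)
  have hc : ∀ s, s ≤ 4 * k * c s := by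
    intro s
    have h1 := Nat.div_add_mod (s + 4 * k - 1) (4 * k)
    have h2 := Nat.mod_lt (s + 4 * k - 1) (by omega : 4 * k > 0)
    simp only [c]
    omega
  have hc' : ∀ s f, (4 * k + 1) * s ≤ 4 * k * f → s + c s ≤ f := by
    intro s f h
    have h1 : c s < f - s + 1 := by
      rw [Nat.div_lt_iff_lt_mul (by omega)]
      have h2 : s ≤ f := by
        by_contra! hlt
        nlinarith
      obtain ⟨d, rfl⟩ := Nat.exists_eq_add_of_le h2
      have h3 : s ≤ 4 * k * d := by nlinarith
      rw [Nat.add_sub_cancel_left]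
      have h4 : (d + 1) * (4 * k) = 4 * k * d + 4 * k := by ring
      omega
    have h2 : s ≤ f := by
      by_contra! hlt
      nlinarith
    omega
  have hbad : {σ : EdgeOrdering n | ¬ LocallySparse (graph m σ) k t} ⊆
      ⋃ s ∈ Finset.Icc 1 t, {σ | ∃ S ∈ powersetCard s (univ : Finset (Fin n)),
        ∃ F ∈ powersetCard (s + c s) S.sym2,
          (F : Set (Sym2 (Fin n))) ⊆ (graph m σ).edgeSet} := by
    intro σ hσ
    simp only [Set.mem_ofPred_eq, LocallySparse, not_forall, not_lt] at hσ
    obtain ⟨S, F, hFS, hS, hSt, hF, h⟩ := hσ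
    obtain ⟨F', hF', hF'c⟩ := exists_subset_card_eq (hc' _ _ h)
    simp only [Set.mem_iUnion]
    refine ⟨#S, Finset.mem_Icc.2 ⟨hS.card_pos, hSt⟩, S, by simp, F', ?_, ?_⟩
    · exact mem_powersetCard.2 ⟨hF'.trans hFS, hF'c⟩
    · exact (coe_subset.2 hF').trans hF
  refine (measureReal_mono hbad (measure_ne_top _ _)).trans ((measureReal_biUnion_finset_le _ _).trans ?_)
  refine le_trans (sum_le_sum (g := fun a => q ^ a) fun s hs => ?_) (sum_Icc_pow_le hq0 hq t)
  obtain ⟨hs1, hst⟩ := Finset.mem_Icc.1 hs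
  have hs1' : (0:ℝ) < s := by exact_mod_cast hs1
  have hst' : (s:ℝ) ≤ t := by exact_mod_cast hst
  have hesp : Real.exp 1 * s * p ≤ y ^ (4 * k) := le_trans (by gcongr) hp
  have hset : ∀ S ∈ powersetCard s (univ : Finset (Fin n)),
      (orderingMeasure n).real {σ | ∃ F ∈ powersetCard (s + c s) S.sym2,
        (F : Set (Sym2 (Fin n))) ⊆ (graph m σ).edgeSet} ≤ (Real.exp 1 * s * p) ^ s * y ^ s := by
    intro S hS
    refine (measureReal_exists_le (orderingMeasure n) (powersetCard (s + c s) S.sym2) _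
      (b := p ^ (s + c s)) fun F hF => ?_).trans ?_
    · rw [← (mem_powersetCard.1 hF).2]
      exact measureReal_subset_edgeSet_le m F
    rw [card_powersetCard]
    have h1 : (#S.sym2 : ℝ) ≤ s * s := by
      rw [card_sym2, (mem_powersetCard.1 hS).2]
      have : (s + 1).choose 2 ≤ s * s := by
        rw [Nat.choose_two_right, Nat.add_sub_cancel]
        exact Nat.div_le_of_le_mul (by nlinarith)
      exact_mod_cast this
    calc ((#S.sym2).choose (s + c s) : ℝ) * p ^ (s + c s)
        ≤ (Real.exp 1 * s) ^ (s + c s) * p ^ (s + c s) := by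
          gcongr
          refine (choose_le_div_pow_mul_exp _ _).trans ?_
          gcongr
          rw [div_le_iff₀ (by positivity)]
          refine h1.trans ?_
          gcongr
          simp
      _ = (Real.exp 1 * s * p) ^ s * (Real.exp 1 * s * p) ^ c s := by
          rw [← mul_pow, pow_add]
      _ ≤ (Real.exp 1 * s * p) ^ s * y ^ s := by
          gcongr
          calc (Real.exp 1 * s * p) ^ c s ≤ (y ^ (4 * k)) ^ c s := by gcongr
            _ = y ^ (4 * k * c s) := (pow_mul _ _ _).symm
            _ ≤ y ^ s := pow_le_pow_of_le_one hy0 hy1 (hc s)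
  refine (measureReal_exists_le (orderingMeasure n) _ _ hset).trans ?_
  rw [card_powersetCard, card_univ, Fintype.card_fin]
  calc (n.choose s : ℝ) * ((Real.exp 1 * s * p) ^ s * y ^ s)
      ≤ (Real.exp 1 * (n / s)) ^ s * ((Real.exp 1 * s * p) ^ s * y ^ s) := by
        gcongr
        exact choose_le_div_pow_mul_exp n s
    _ = q ^ s := by
        have h2 : Real.exp 2 = Real.exp 1 * Real.exp 1 := by rw [← Real.exp_add]; norm_num
        rw [hq_def, h2, ← mul_pow, ← mul_pow]
        congr 1
        field_simp

/-! ### Second moment method, isolated vertices and the hitting time -/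

open Classical in
/-- The second moment method for a family of events on a finite set. -/
theorem card_forall_notMem_mul_sq_le {Ω ι : Type*} [Fintype Ω] [Fintype ι] (E : ι → Ω → Prop)
    (c : ℝ) :
    (#{σ | ∀ v, ¬ E v σ} : ℝ) * c ^ 2 ≤ ∑ u, ∑ v, (#{σ | E u σ ∧ E v σ} : ℝ) -
      2 * c * ∑ v, (#{σ | E v σ} : ℝ) + c ^ 2 * Fintype.card Ω := by
  have h1 : ∀ v, (#{σ | E v σ} : ℝ) = ∑ σ, if E v σ then (1:ℝ) else 0 := by
    intro v; simp
  have h2 : ∀ u v, (#{σ | E u σ ∧ E v σ} : ℝ) =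
      ∑ σ, (if E u σ then (1:ℝ) else 0) * (if E v σ then (1:ℝ) else 0) := by
    intro u v
    simp [← ite_and, and_comm]
  have h3 : (#{σ | ∀ v, ¬ E v σ} : ℝ) = ∑ σ, if ∀ v, ¬ E v σ then (1:ℝ) else 0 := by simp
  have h4 : ∑ u, ∑ v, (#{σ | E u σ ∧ E v σ} : ℝ) =
      ∑ σ, (∑ v, if E v σ then (1:ℝ) else 0) ^ 2 := by
    simp_rw [h2, sq, sum_mul_sum]
    rw [sum_comm]
    refine Eq.trans ?_ sum_comm
    rw [sum_comm]
    exact sum_congr rfl fun u _ => sum_comm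
  have h5 : ∑ v, (#{σ | E v σ} : ℝ) = ∑ σ, ∑ v, if E v σ then (1:ℝ) else 0 := by
    simp_rw [h1]
    exact sum_comm
  have h6 : (Fintype.card Ω : ℝ) = ∑ _σ : Ω, (1:ℝ) := by simp
  rw [h3, h4, h5, h6, sum_mul, mul_sum, mul_sum, ← sum_sub_distrib, ← sum_add_distrib]
  -- Pointwise, with `X` the number of events that occur, the indicator of `X = 0` times `c ^ 2` is
  -- at most `(X - c) ^ 2`.
  refine sum_le_sum fun σ _ => ?_
  split_ifs with h
  · have : ∑ v, (if E v σ then (1:ℝ) else 0) = 0 := sum_eq_zero fun v _ => if_neg (h v)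
    rw [this]
    simp
  · nlinarith [sq_nonneg ((∑ v, if E v σ then (1:ℝ) else 0) - c)]

/-- Chebyshev's inequality: take `c` to be the expected number of events. -/
theorem measureReal_forall_not_le {n : ℕ} {ι : Type*} [Fintype ι] [Nonempty ι]
    (E : ι → EdgeOrdering n → Prop) {p ε : ℝ} (hp : 0 < p) (hε : 0 ≤ ε)
    (h1 : ∀ v, (orderingMeasure n).real {σ | E v σ} = p)
    (h2 : ∀ u v, u ≠ v → (orderingMeasure n).real {σ | E u σ ∧ E v σ} ≤ p ^ 2 * (1 + ε)) :
    (orderingMeasure n).real {σ | ∀ v, ¬ E v σ} ≤ 1 / (Fintype.card ι * p) + ε := by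
  classical
  have hN : (0:ℝ) < Fintype.card (EdgeOrdering n) := by exact_mod_cast Fintype.card_pos
  have hι : (0:ℝ) < Fintype.card ι := by exact_mod_cast Fintype.card_pos
  set N : ℝ := (Fintype.card (EdgeOrdering n) : ℝ)
  set d : ℝ := (Fintype.card ι : ℝ)
  have h1' : ∀ v, (#{σ | E v σ} : ℝ) = p * N := by
    intro v
    rw [← h1 v, orderingMeasure_real, div_mul_cancel₀ _ hN.ne']
  have h2' : ∀ u v, (#{σ | E u σ ∧ E v σ} : ℝ) ≤ (if u = v then p * N else 0) +
      p ^ 2 * (1 + ε) * N := by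
    intro u v
    split_ifs with h
    · subst h
      simp only [and_self, h1']
      have : 0 ≤ p ^ 2 * (1 + ε) * N := by positivity
      linarith
    · have := h2 u v h
      rw [orderingMeasure_real, div_le_iff₀ hN] at this
      linarith
  have h := card_forall_notMem_mul_sq_le E (d * p)
  have h3 : ∑ u, ∑ v, (#{σ | E u σ ∧ E v σ} : ℝ) ≤ d * (p * N) + d * (d * (p ^ 2 * (1 + ε) * N)) := by
    refine (sum_le_sum fun u _ => sum_le_sum fun v _ => h2' u v).trans (le_of_eq ?_)
    simp [sum_add_distrib, d]
  have h4 : ∑ v, (#{σ | E v σ} : ℝ) = d * (p * N) := by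
    simp [h1', d]
  rw [h4] at h
  rw [orderingMeasure_real, div_le_iff₀ hN]
  have hdp : 0 < (d * p) ^ 2 := by positivity
  refine le_of_mul_le_mul_right (h.trans ?_) hdp
  have h5 : (1 / (d * p) + ε) * N * (d * p) ^ 2 = d * p * N + ε * N * (d * p) ^ 2 := by
    field_simp
  rw [h5]
  linarith

/-- With few edges it is unlikely that no vertex is isolated. -/
theorem measureReal_forall_degree_pos_le {n m : ℕ} (hn : 2 ≤ n) (hm : 2 * n + m ≤ n.choose 2) :
    (orderingMeasure n).real {σ | ∀ v, ∃ w, (graph m σ).Adj v w} ≤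
      1 / (n * mapsToProb (n.choose 2) (n.choose 2 - m) (n - 1)) +
        m / (n.choose 2 - m - n) := by
  classical
  have : Nonempty (Fin n) := ⟨⟨0, by omega⟩⟩
  set N := n.choose 2
  set T : SimpleGraph (Fin n) := ⊤
  set p := mapsToProb N (N - m) (n - 1) with hp
  have hNm : ((N - m : ℕ) : ℝ) = N - m := Nat.cast_sub (by omega)
  have hmR : 2 * (n:ℝ) + m ≤ N := by exact_mod_cast hm
  have hnR : (2:ℝ) ≤ n := by exact_mod_cast hn
  have hp0 : 0 < p := by
    refine lt_of_lt_of_le (pow_pos ?_ _)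
      (pow_le_mapsToProb (Nat.sub_le _ _) (by omega : n - 1 < N - m))
    rw [hNm, Nat.cast_sub (by omega)]
    push_cast
    have : (0:ℝ) ≤ m := by positivity
    exact div_pos (by linarith) (by linarith)
  have hev : ∀ (σ : EdgeOrdering n) v, (¬ ∃ w, (graph m σ).Adj v w) ↔
      ∀ e ∈ T.incidenceFinset v, e ∉ (graph m σ).edgeSet := by
    intro σ v
    constructor
    · intro h e he hes
      rw [SimpleGraph.mem_incidenceFinset] at he
      obtain ⟨w, rfl⟩ := Sym2.mem_iff_exists.1 he.2
      exact h ⟨w, hes⟩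
    · rintro h ⟨w, hw⟩
      refine h s(v, w) ?_ hw
      rw [SimpleGraph.mem_incidenceFinset]
      exact ⟨hw.ne, Sym2.mem_mk_left _ _⟩
  have hsub : ∀ v, ((T.incidenceFinset v : Finset (Sym2 (Fin n))) : Set (Sym2 (Fin n))) ⊆
      T.edgeSet := by
    intro v e he
    rw [mem_coe, SimpleGraph.mem_incidenceFinset] at he
    exact he.1
  have hcard : ∀ v, #(T.incidenceFinset v) = n - 1 := by
    intro v
    rw [SimpleGraph.card_incidenceFinset_eq_degree]
    simp [T]
  -- The two stars share exactly the edge `uv`, hence `n - 2` in the second summand.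
  have hinter : ∀ u v, u ≠ v →
      #(T.incidenceFinset u ∪ T.incidenceFinset v) = (n - 1) + (n - 2) := by
    intro u v huv
    have h := card_union_add_card_inter (T.incidenceFinset u) (T.incidenceFinset v)
    have h' : T.incidenceFinset u ∩ T.incidenceFinset v = {s(u, v)} := by
      rw [← coe_inj]
      simpa using T.incidenceSet_inter_incidenceSet_of_adj (a := u) (b := v) huv
    rw [h', card_singleton, hcard, hcard] at h
    omega
  have hε : (1 : ℝ) + m / (N - m - n) = (N - n) / (N - m - n) := by
    rw [eq_div_iff (by linarith), add_mul, div_mul_cancel₀ _ (by linarith)]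
    ring
  have hmain := measureReal_forall_not_le (n := n) (ι := Fin n)
    (fun v σ => ¬ ∃ w, (graph m σ).Adj v w) (p := p) (ε := m / (N - m - n)) hp0
    (div_nonneg (by positivity) (by linarith)) ?_ ?_
  · simpa [not_not] using hmain
  · intro v
    simp only [hev]
    rw [measureReal_disjoint_edgeSet m (hsub v), hcard]
  · intro u v huv
    have hset : {σ : EdgeOrdering n | (¬ ∃ w, (graph m σ).Adj u w) ∧ ¬ ∃ w, (graph m σ).Adj v w} =
        {σ | ∀ e ∈ T.incidenceFinset u ∪ T.incidenceFinset v, e ∉ (graph m σ).edgeSet} := by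
      ext σ
      simp only [hev, Set.mem_ofPred_eq, mem_union, or_imp, forall_and]
    rw [hset, measureReal_disjoint_edgeSet m
      (by rw [coe_union]; exact Set.union_subset (hsub u) (hsub v)), hinter u v huv]
    refine (mapsToProb_add_le (Nat.sub_le _ _) (by omega)).trans ?_
    rw [sq, mul_assoc]
    refine mul_le_mul_of_nonneg_left ?_ hp0.le
    -- Sharing one edge costs one factor of the product, which `1 + ε` compensates.
    have h3 : p = mapsToProb N (N - m) (n - 2) * ((N - m - (n - 2)) / (N - (n - 2))) := by
      rw [hp, show n - 1 = (n - 2) + 1 by omega, mapsToProb, prod_range_succ, ← mapsToProb, hNm,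
        Nat.cast_sub (by omega : 2 ≤ n)]
      norm_num
    rw [h3, hε, mul_assoc]
    refine le_mul_of_one_le_right (mapsToProb_nonneg (Nat.sub_le _ _) _) ?_
    rw [div_mul_div_comm, le_div_iff₀ (mul_pos (by linarith) (by linarith))]
    have : (0:ℝ) ≤ m := by positivity
    nlinarith

theorem le_of_minDegreeTime_le {n m M : ℕ} (hn : 2 ≤ n) {σ : EdgeOrdering n}
    (hm : ¬ ∀ v, ∃ w, (graph m σ).Adj v w) (hM : minDegreeTime 1 σ ≤ M) : m ≤ M := by
  classical
  by_contra! hlt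
  have : Nonempty (Fin n) := ⟨⟨0, by omega⟩⟩
  have hmem : minDegreeTime 1 σ ∈
      {M : ℕ | M ≤ n.choose 2 ∧ 1 ≤ (graph M σ).minDegree} := by
    -- The complete graph shows that the set is nonempty, so its infimum is attained and is not the
    -- default `0`.
    refine Nat.sInf_mem ⟨n.choose 2, le_rfl, ?_⟩
    have htop : graph (n.choose 2) σ = ⊤ := by
      refine top_le_iff.1 (SimpleGraph.edgeSet_subset_edgeSet.1 fun e he => ?_)
      exact (mem_edgeSet_graph he).2 (Finset.mem_Icc.1 (σ ⟨e, he⟩).2).2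
    refine SimpleGraph.le_minDegree_of_forall_le_degree _ _ fun v => ?_
    rw [Nat.one_le_iff_ne_zero, ← Nat.pos_iff_ne_zero, SimpleGraph.degree_pos_iff_exists_adj, htop]
    have : Nontrivial (Fin n) := Fin.nontrivial_iff_two_le.2 hn
    obtain ⟨w, hw⟩ := exists_ne v
    exact ⟨w, hw.symm⟩
  refine hm fun v => ?_
  have h1 := hmem.2.trans ((graph (minDegreeTime 1 σ) σ).minDegree_le_degree v)
  obtain ⟨w, hw⟩ := (SimpleGraph.degree_pos_iff_exists_adj _ v).1 h1
  exact ⟨w, graph_mono (hM.trans hlt.le) σ hw⟩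

theorem exp_neg_two_mul_le_one_sub {x : ℝ} (h0 : 0 ≤ x) (h1 : x ≤ 1 / 2) :
    Real.exp (-(2 * x)) ≤ 1 - x := by
  rw [Real.exp_neg, inv_le_comm₀ (Real.exp_pos _) (by linarith)]
  refine le_trans ?_ (Real.add_one_le_exp (2 * x))
  rw [inv_le_iff_one_le_mul₀ (by linarith)]
  nlinarith

/-- At time `n log n / 16` there is an isolated vertex, with high probability. -/
theorem measureReal_forall_degree_pos_floor_le {n : ℕ} (hn : 8 ≤ n) :
    (orderingMeasure n).real {σ | ∀ v, ∃ w, (graph ⌊n * Real.log n / 16⌋₊ σ).Adj v w} ≤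
      Real.exp (-(Real.log n / 2)) + Real.log n * Real.exp (-Real.log n) := by
  have hnR : (8:ℝ) ≤ n := by exact_mod_cast hn
  have hn0 : (0:ℝ) < n := by linarith
  set x := Real.log n with hx
  have hexp : Real.exp x = n := Real.exp_log hn0
  have hx0 : 0 ≤ x := Real.log_nonneg (by linarith)
  have hxn : x ≤ n := (Real.log_le_sub_one_of_pos hn0).trans (by linarith)
  set m := ⌊n * x / 16⌋₊ with hm
  have hm1 : (m:ℝ) ≤ n * x / 16 := Nat.floor_le (by positivity)
  have hm0 : (0:ℝ) ≤ m := by positivity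
  have hm2 : (m:ℝ) ≤ n * n / 16 := hm1.trans (by gcongr)
  have hN : (n.choose 2 : ℝ) = n * (n - 1) / 2 := Nat.cast_choose_two ℝ n
  have hmN : 2 * n + m ≤ n.choose 2 := by
    have : 2 * (n:ℝ) + m ≤ n.choose 2 := by rw [hN]; nlinarith
    exact_mod_cast this
  refine (measureReal_forall_degree_pos_le (by omega) hmN).trans (add_le_add ?_ ?_)
  · have hlow : Real.exp (-(x / 2)) ≤ mapsToProb (n.choose 2) (n.choose 2 - m) (n - 1) := by
      refine le_trans ?_ (pow_le_mapsToProb (Nat.sub_le _ _) (by omega))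
      rw [Nat.cast_sub (by omega), Nat.cast_sub (by omega : 1 ≤ n), Nat.cast_one]
      have hpos : (0:ℝ) < n.choose 2 - (n - 1) := by rw [hN]; nlinarith
      -- Every factor of the product is at least `1 - z`. Since the denominator is `(n - 1) * (n -
      -- 2) / 2`, the exponent `2 * z * (n - 1)` is at most `x / 2`.
      set z : ℝ := m / (n.choose 2 - (n - 1)) with hz
      have hz0 : 0 ≤ z := by positivity
      have hz1 : z ≤ 1 / 2 := by
        rw [hz, div_le_iff₀ hpos, hN]
        nlinarith
      have hz2 : ((n.choose 2 : ℝ) - m - (n - 1)) / (n.choose 2 - (n - 1)) = 1 - z := by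
        rw [hz]
        field_simp
        ring
      rw [hz2]
      calc Real.exp (-(x / 2)) ≤ Real.exp (-(2 * z)) ^ (n - 1) := by
            rw [← Real.exp_nat_mul, Real.exp_le_exp, Nat.cast_sub (by omega : 1 ≤ n), Nat.cast_one]
            have h1 : z * ((n - 1) * (n - 2) / 2) = m := by
              rw [show (n - 1) * (n - 2) / 2 = (n.choose 2 : ℝ) - (n - 1) by rw [hN]; ring, hz,
                div_mul_cancel₀ _ hpos.ne']
            have h2 : (n - 1) * z * (n - 2) = 2 * m := by linarith
            have h3 : (n - 1) * z ≤ x / 4 := by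
              have h4 : (n - 1) * z * (n - 2) ≤ x / 4 * (n - 2) := by
                rw [h2]
                nlinarith
              exact le_of_mul_le_mul_right h4 (by linarith)
            linarith
        _ ≤ (1 - z) ^ (n - 1) := by
            gcongr
            exact exp_neg_two_mul_le_one_sub hz0 hz1
    calc 1 / (n * mapsToProb (n.choose 2) (n.choose 2 - m) (n - 1))
        ≤ 1 / (Real.exp x * Real.exp (-(x / 2))) := by
          rw [hexp]
          gcongr
      _ = _ := by
          rw [← Real.exp_add, one_div, ← Real.exp_neg]
          congr 1
          ring
  · rw [Real.exp_neg, hexp, div_le_iff₀ (by rw [hN]; nlinarith)]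
    calc (m:ℝ) ≤ x * (n:ℝ)⁻¹ * (n * n / 8) := by
          field_simp
          linarith
      _ ≤ _ := by
          gcongr
          rw [hN]
          nlinarith

/-! ### Choice of parameters and assembly -/

open Classical in
/-- Expansion at a time `m₀` before every vertex has positive degree, together with sparsity and
expansion at a later time `m₁`, control the `k`-core at all times from `m₀` on. -/
theorem kCore_graph_of_expands {n k m₀ m₁ a₀ M : ℕ} {σ : EdgeOrdering n} (hk : 3 ≤ k)
    (ha₀ : 0 < a₀) (hn : 4 * ((k + 1) * a₀) ≤ n) (h₀ : Expands (graph m₀ σ) k a₀)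
    (h₁ : Expands (graph m₁ σ) k 1) (hs : LocallySparse (graph m₁ σ) k (a₀ + k)) (hM : m₀ ≤ M) :
    IsKConnected k (kCore (graph M σ) k).coe ∧
      5 * (n : ℝ) / 9 ≤ ((kCore (graph M σ) k).verts.ncard : ℝ) := by
  have hn1 : k + 1 ≤ (k + 1) * a₀ := Nat.le_mul_of_pos_right _ ha₀
  have hn2 : a₀ + k ≤ (k + 1) * a₀ := by nlinarith
  have hE₀ : Expands (graph M σ) k a₀ := h₀.mono (graph_mono hM σ)
  have hK₀ := hE₀.card_notMem_kCore_lt ha₀ (by simpa using hn)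
  constructor
  · rcases le_total M m₁ with h | h
    · exact isKConnected_kCore hk hE₀ (Or.inr (hs.anti (graph_mono h σ))) hK₀
        (by rw [Fintype.card_fin]; omega)
    -- With `a₀ = 1` no vertex lies outside the core and no nonempty set is too small to expand.
    · have hE₁ : Expands (graph M σ) k 1 := h₁.mono (graph_mono h σ)
      exact isKConnected_kCore hk hE₁ (Or.inl le_rfl)
        (hE₁.card_notMem_kCore_lt one_pos (by rw [Fintype.card_fin]; omega))
        (by rw [Fintype.card_fin]; omega)
  · have h1 : (kCore (graph M σ) k).verts.ncard = #{v | v ∈ (kCore (graph M σ) k).verts} := by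
      rw [← Set.ncard_coe_finset]
      congr 1
      ext v
      simp
    have h2 := card_filter_add_card_filter_not (s := (univ : Finset (Fin n)))
      (fun v => v ∈ (kCore (graph M σ) k).verts)
    rw [card_univ, Fintype.card_fin, ← h1] at h2
    -- Fewer than `a₀ ≤ n / 16` vertices are missing, so `5 / 9` is far from tight.
    have h3 : 5 * n ≤ 9 * (kCore (graph M σ) k).verts.ncard := by nlinarith
    have h4 : 5 * (n : ℝ) ≤ 9 * ((kCore (graph M σ) k).verts.ncard : ℝ) := by exact_mod_cast h3
    linarith

/-- The total failure probability in terms of `x = log n`. -/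
noncomputable def failureBound (k : ℕ) (x : ℝ) : ℝ :=
  (Real.exp (-(x / 2)) + x * Real.exp (-x)) +
    2 * (Real.exp 2 * (x ^ (8 * k + 2)) ^ (k + 2) * Real.exp (-(x / 64))) +
    2 * (Real.exp 2 * Real.exp x ^ (k + 2) * Real.exp (-((k + 3) * x))) +
    2 * (Real.exp 2 * (8 * (2 * k + 6)) / x)

theorem tendsto_pow_mul_exp_neg_div (j : ℕ) {c : ℝ} (hc : 0 < c) :
    Tendsto (fun x : ℝ => x ^ j * Real.exp (-(x / c))) atTop (𝓝 0) := by
  have h := (Real.tendsto_pow_mul_exp_neg_atTop_nhds_zero j).comp (tendsto_id.atTop_div_const hc)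
  have h' := h.const_mul (c ^ j)
  rw [mul_zero] at h'
  refine h'.congr fun x => ?_
  simp only [Function.comp_apply, id_eq, div_pow]
  field_simp

theorem tendsto_failureBound (k : ℕ) : Tendsto (failureBound k) atTop (𝓝 0) := by
  have h1 := tendsto_pow_mul_exp_neg_div 0 (c := 2) (by norm_num)
  have h2 := tendsto_pow_mul_exp_neg_div 1 (c := 1) (by norm_num)
  have h3 := tendsto_pow_mul_exp_neg_div ((8 * k + 2) * (k + 2)) (c := 64) (by norm_num)
  have h4 := tendsto_pow_mul_exp_neg_div 0 (c := 1) (by norm_num)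
  have h5 := tendsto_inv_atTop_zero (𝕜 := ℝ)
  have h := ((((h1.add h2).add (h3.const_mul (2 * Real.exp 2))).add
    (h4.const_mul (2 * Real.exp 2)))).add (h5.const_mul (2 * (Real.exp 2 * (8 * (2 * k + 6)))))
  simp only [mul_zero, add_zero] at h
  refine h.congr fun x => ?_
  have h6 : Real.exp x ^ (k + 2) * Real.exp (-((k + 3) * x)) = Real.exp (-x) := by
    rw [← Real.exp_nat_mul, ← Real.exp_add]
    congr 1
    push_cast
    ring
  rw [failureBound, mul_assoc (Real.exp 2) (Real.exp x ^ (k + 2)), h6, ← pow_mul]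
  simp only [pow_zero, pow_one, one_mul, div_one]
  ring

theorem mul_div_choose_two_ge {n m : ℕ} (hn : 2 ≤ n) :
    (m : ℝ) / (2 * n) ≤ (m : ℝ) / n.choose 2 * (n / 4) := by
  have hnR : (2:ℝ) ≤ n := by exact_mod_cast hn
  have h1 : (0:ℝ) < n - 1 := by linarith
  rw [Nat.cast_choose_two ℝ n, div_mul_div_comm, div_le_div_iff₀ (by linarith) (by positivity)]
  have : (0:ℝ) ≤ m * n := by positivity
  nlinarith

theorem aas_of_measureReal_le {P : ∀ n, EdgeOrdering n → Prop} {b : ℕ → ℝ}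
    (hb : Tendsto b atTop (𝓝 0))
    (h : ∀ᶠ n in atTop, (orderingMeasure n).real {σ | ¬ P n σ} ≤ b n) : AAS orderingMeasure P := by
  have h1 : Tendsto (fun n => (orderingMeasure n).real {σ | P n σ}) atTop (𝓝 1) := by
    have h2 : Tendsto (fun n => 1 - b n) atTop (𝓝 1) := by simpa using hb.const_sub 1
    refine tendsto_of_tendsto_of_tendsto_of_le_of_le' h2 tendsto_const_nhds ?_
      (Eventually.of_forall fun n => measureReal_le_one)
    filter_upwards [h] with n hn
    have h3 := probReal_compl_eq_one_sub (μ := orderingMeasure n) (s := {σ | P n σ})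
      (MeasurableSet.of_discrete)
    have h4 : {σ | P n σ}ᶜ = {σ : EdgeOrdering n | ¬ P n σ} := rfl
    rw [h4] at h3
    linarith
  have h2 := ENNReal.tendsto_ofReal h1
  rw [ENNReal.ofReal_one] at h2
  exact h2.congr fun n => ofReal_measureReal

set_option maxHeartbeats 1000000 in
theorem measureReal_failure_le {n k : ℕ} (hk : 3 ≤ k) (hn : 8 * (k + 1) ≤ n)
    (hx1 : 32 * Real.exp 1 * (2 * k + 6) ≤ Real.log n)
    (hx2 : (k + 1 : ℝ) * (Real.log n ^ (8 * k + 2) * Real.exp (-(Real.log n / 1))) ≤ 1)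
    (hb : failureBound k (Real.log n) ≤ 1) :
    (orderingMeasure n).real {σ | ¬ ∀ M : ℕ, minDegreeTime 1 σ ≤ M → M ≤ n.choose 2 →
        IsKConnected k (kCore (graph M σ) k).coe ∧
          5 * (n : ℝ) / 9 ≤ ((kCore (graph M σ) k).verts.ncard : ℝ)} ≤
      failureBound k (Real.log n) := by
  have hkR : (3:ℝ) ≤ k := by exact_mod_cast hk
  have hnR : 8 * ((k:ℝ) + 1) ≤ n := by exact_mod_cast hn
  have hn0 : (0:ℝ) < n := by linarith
  set x := Real.log n with hx
  have hexp : Real.exp x = n := Real.exp_log hn0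
  have he1 : (1:ℝ) ≤ Real.exp 1 := Real.one_le_exp (by norm_num)
  -- Half of `C` is `k + 3`, so expansion at `m₁` has exponent `(k + 3) * x` against a union bound
  -- of order `n ^ (k + 2)`, leaving `1 / n`.
  set C : ℝ := 2 * k + 6 with hC
  have hCpos : 0 < C := by positivity
  have hxC : 32 * C ≤ x := le_trans (by gcongr; linarith) hx1
  have hx0 : 0 < x := by linarith
  have hx_one : 1 ≤ x := by linarith
  -- Chosen so that `x ^ 2 / x ^ c = (x ^ 2)⁻¹ ^ (4 * k)`, the sparsity requirement for `y = (x ^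
  -- 2)⁻¹`.
  set c := 8 * k + 2 with hc
  set a₀ := ⌈n / x ^ c⌉₊ with ha₀
  set m₀ := ⌊n * x / 16⌋₊ with hm₀
  set m₁ := ⌈C * (n * x)⌉₊ with hm₁
  have hxc : x ≤ x ^ c := le_self_pow₀ hx_one (by omega)
  have hxc0 : 0 < x ^ c := by positivity
  have ha₀pos : 0 < a₀ := Nat.ceil_pos.2 (by positivity)
  have ha₀le : (a₀ : ℝ) ≤ n / x ^ c + 1 := (Nat.ceil_lt_add_one (by positivity)).le
  have hcard : 4 * ((k + 1) * a₀) ≤ n := by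
    have h1 : (n:ℝ) / x ^ c ≤ n / (8 * (k + 1)) := by
      gcongr
      linarith
    have h2 : 4 * (((k:ℝ) + 1) * a₀) ≤ n := by
      calc 4 * (((k:ℝ) + 1) * a₀) ≤ 4 * ((k + 1) * (n / (8 * (k + 1)) + 1)) := by
            gcongr
            linarith
        _ = n / 2 + 4 * (k + 1) := by field_simp; ring
        _ ≤ n := by linarith
    exact_mod_cast h2
  have ht : ((a₀ + k : ℕ) : ℝ) ≤ 2 * n / x ^ c := by
    have h1 : (k + 1 : ℝ) ≤ n / x ^ c := by
      rw [div_one, Real.exp_neg, hexp, ← div_eq_mul_inv, mul_div_assoc', div_le_one hn0] at hx2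
      rw [le_div_iff₀ hxc0]
      exact hx2
    push_cast
    rw [mul_div_assoc]
    linarith
  have hN : (n.choose 2 : ℝ) = n * (n - 1) / 2 := Nat.cast_choose_two ℝ n
  have hm₁lb : C * (n * x) ≤ m₁ := Nat.le_ceil _
  have hnx : (32:ℝ) ≤ n * x := by
    calc (32:ℝ) = 32 * 1 := by ring
      _ ≤ n * x := by gcongr; linarith
  have hm₁ub : (m₁ : ℝ) ≤ 2 * C * (n * x) := by
    have : (m₁ : ℝ) ≤ C * (n * x) + 1 := (Nat.ceil_lt_add_one (by positivity)).le
    nlinarith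
  have hm₀lb : n * x / 32 ≤ m₀ := by
    have : n * x / 16 - 1 ≤ m₀ := (Nat.sub_one_lt_floor _).le
    linarith
  have hp : (m₁ : ℝ) / n.choose 2 ≤ 8 * C * x / n := by
    rw [hN, div_le_div_iff₀ (by nlinarith) hn0]
    have h1 : n * n / 4 ≤ (n * (n - 1) / 2 : ℝ) := by nlinarith
    calc (m₁ : ℝ) * n ≤ 2 * C * (n * x) * n := by gcongr
      _ = 8 * C * x * (n * n / 4) := by ring
      _ ≤ _ := by gcongr
  have hb1 : 0 ≤ Real.exp (-(x / 2)) + x * Real.exp (-x) := by positivity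
  have hb2 : 0 ≤ Real.exp 2 * (x ^ c) ^ (k + 2) * Real.exp (-(x / 64)) := by positivity
  have hb3 : 0 ≤ Real.exp 2 * Real.exp x ^ (k + 2) * Real.exp (-((k + 3) * x)) := by positivity
  have hb4 : 0 ≤ Real.exp 2 * (8 * C) / x := by positivity
  have hfb : failureBound k x = (Real.exp (-(x / 2)) + x * Real.exp (-x)) +
    2 * (Real.exp 2 * (x ^ c) ^ (k + 2) * Real.exp (-(x / 64))) +
    2 * (Real.exp 2 * Real.exp x ^ (k + 2) * Real.exp (-((k + 3) * x))) +
    2 * (Real.exp 2 * (8 * C) / x) := rfl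
  rw [hfb] at hb
  have hiso := measureReal_forall_degree_pos_floor_le (n := n) (by omega)
  -- For sets of at least `a₀` vertices the ratio `n / a` is at most a power of `log n`, which even
  -- `exp (-(x / 64))` beats.
  have hexp₀ := measureReal_not_expands_le (n := n) (k := k) (a₀ := a₀) (m := m₀) (D := x ^ c)
    (r := x / 64) (by omega) (fun a ha ha' => by
      have h1 : (n : ℝ) / x ^ c ≤ a := (Nat.le_ceil _).trans (by exact_mod_cast ha)
      rw [div_le_iff₀ hxc0] at h1
      rw [div_le_iff₀ (by exact_mod_cast ha'), mul_comm]
      exact h1)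
    (le_trans (by rw [le_div_iff₀ (by positivity)]; linarith) (mul_div_choose_two_ge (by omega)))
    (by linarith)
  have hexp₁ := measureReal_not_expands_le (n := n) (k := k) (a₀ := 1) (m := m₁)
    (D := Real.exp x) (r := (k + 3) * x) (by omega) (fun a _ ha' => by
      rw [hexp]
      exact div_le_self hn0.le (by exact_mod_cast ha'))
    (le_trans (by rw [le_div_iff₀ (by positivity)]; nlinarith) (mul_div_choose_two_ge (by omega)))
    (by linarith)
  have hq : Real.exp 2 * n * ((m₁ : ℝ) / n.choose 2) * (x ^ 2)⁻¹ ≤ Real.exp 2 * (8 * C) / x := by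
    calc Real.exp 2 * n * ((m₁ : ℝ) / n.choose 2) * (x ^ 2)⁻¹
        ≤ Real.exp 2 * n * (8 * C * x / n) * (x ^ 2)⁻¹ := by gcongr
      _ = _ := by field_simp
  -- The density at `m₁` is of order `x / n`, so `y = (x ^ 2)⁻¹` leaves a bound of order `1 / x`,
  -- the slowest term of `failureBound`.
  have hsparse := measureReal_not_locallySparse_le (n := n) (k := k) (t := a₀ + k) (m := m₁)
    (y := (x ^ 2)⁻¹) (by omega) (by positivity) (inv_le_one_of_one_le₀ (one_le_pow₀ hx_one)) (by
      calc Real.exp 1 * (a₀ + k : ℕ) * ((m₁ : ℝ) / n.choose 2)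
          ≤ Real.exp 1 * (2 * n / x ^ c) * (8 * C * x / n) := by gcongr
        _ = (16 * Real.exp 1 * C) * (x / x ^ c) := by field_simp; ring
        _ ≤ x * (x / x ^ c) := by
            gcongr
            linarith [mul_pos (Real.exp_pos 1) hCpos]
        _ = ((x ^ 2)⁻¹) ^ (4 * k) := by
            rw [hc, inv_pow, ← pow_mul, pow_add, show 2 * (4 * k) = 8 * k by ring]
            field_simp)
    (by linarith)
  rw [hfb]
  refine le_trans (measureReal_mono (s₂ :=
    {σ : EdgeOrdering n | ∀ v, ∃ w, (graph m₀ σ).Adj v w} ∪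
    {σ | ¬ Expands (graph m₀ σ) k a₀} ∪ {σ | ¬ Expands (graph m₁ σ) k 1} ∪
    {σ | ¬ LocallySparse (graph m₁ σ) k (a₀ + k)}) ?_ (measure_ne_top _ _)) ?_
  · intro σ hσ
    by_contra hcon
    simp only [Set.mem_union, Set.mem_ofPred_eq, not_or, not_not] at hcon
    obtain ⟨⟨⟨h1, h2⟩, h3⟩, h4⟩ := hcon
    exact hσ fun M hM _ => kCore_graph_of_expands hk ha₀pos hcard h2 h3 h4
      (le_of_minDegreeTime_le (by omega) h1 hM)
  · refine (measureReal_union_le _ _).trans (add_le_add ?_ (hsparse.trans (by gcongr)))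
    refine (measureReal_union_le _ _).trans (add_le_add ?_ hexp₁)
    exact (measureReal_union_le _ _).trans (add_le_add hiso hexp₀)

end RandomCore

theorem mainTheorem5 (k : ℕ) (hk : 3 ≤ k) :
    RandomCore.AAS RandomCore.orderingMeasure fun n σ =>
      ∀ M : ℕ, RandomCore.minDegreeTime 1 σ ≤ M → M ≤ n.choose 2 →
        RandomCore.IsKConnected k (RandomCore.kCore (RandomCore.graph M σ) k).coe ∧
          5 * (n : ℝ) / 9 ≤ ((RandomCore.kCore (RandomCore.graph M σ) k).verts.ncard : ℝ) := by
  have hlog : Tendsto (fun n : ℕ => Real.log n) atTop atTop :=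
    Real.tendsto_log_atTop.comp tendsto_natCast_atTop_atTop
  have hb := (RandomCore.tendsto_failureBound k).comp hlog
  have hx2 := ((RandomCore.tendsto_pow_mul_exp_neg_div (8 * k + 2) one_pos).const_mul
    (k + 1 : ℝ)).comp hlog
  rw [mul_zero] at hx2
  refine RandomCore.aas_of_measureReal_le hb ?_
  filter_upwards [eventually_ge_atTop (8 * (k + 1)),
    hlog.eventually_ge_atTop (32 * Real.exp 1 * (2 * k + 6)), hx2.eventually_le_const one_pos,
    hb.eventually_le_const one_pos] with n h1 h2 h3 h4
  exact RandomCore.measureReal_failure_le hk h1 h2 h3 h4
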